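/- For complex numbers $\omega,\omega'$ with $\operatorname{Im}(\omega'/\omega)\neq 0$ let $\Lambda=\{2m\omega+2n\omega' : m,n\in\mathbb{Z}\}$, and let $\sigma,\zeta,\wp,\wp'$ be the Weierstrass functions of $\Lambda$, regarded as functions of $(z,\omega,\omega')$: $$\sigma=z\prod_{0\ne l\in\Lambda}\Bigl(1-\frac zl\Bigr)e^{\frac zl+\frac{z^2}{2l^2}},\qquad \zeta=\frac1z+\sum_{0\ne l\in\Lambda}\Bigl(\frac1{z-l}+\frac1l+\frac z{l^2}\Bigr),$$ $$\wp=\frac1{z^2}+\sum_{0\ne l\in\Lambda}\Bigl(\frac1{(z-l)^2}-\frac1{l^2}\Bigr),\qquad \wp'=-\sum_{l\in\Lambda}\frac2{(z-l)^3}.$$ Put $g_2=60\sum_{0\neq l\in\Lambda}l^{-4}$, $\eta=\zeta(\omega|\omega,\omega')$, $\eta'=\zeta(\omega'|\omega,\omega')$ and $\mathfrak{s}=\operatorname{sign}\operatorname{Im}(\omega'/\omega)\in\{1,-1\}$. **Theorem.** Let $z\notin\Lambda$. Then $\sigma,\zeta,\wp,\wp'$ have complex partial derivatives in $\omega$ and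 in $\omega'$ (with $z$ fixed), and $$\begin{aligned} \mathfrak{s}\,\partial_\omega\sigma&=-\tfrac{i}{\pi}\bigl\{\omega'(\wp-\zeta^2-\tfrac1{12}g_2z^2)+2\eta'(z\zeta-1)\bigr\}\sigma,\\ \mathfrak{s}\,\partial_{\omega'}\sigma&=\tfrac{i}{\pi}\bigl\{\omega(\wp-\zeta^2-\tfrac1{12}g_2z^2)+2\eta(z\zeta-1)\bigr\}\sigma,\\ \mathfrak{s}\,\partial_\omega\zeta&=-\tfrac{i}{\pi}\bigl\{2(\omega'\zeta-z\eta')\wp+\omega'(\wp'-\tfrac16g_2z)+2\eta'\zeta\bigr\},\\ \mathfrak{s}\,\partial_{\omega'}\zeta&=\tfrac{i}{\pi}\bigl\{2(\omega\zeta-z\eta)\wp+\omega(\wp'-\tfrac16g_2z)+2\eta\zeta\bigr\},\\ \mathfrak{s}\,\partial_\omega\wp&=\tfrac{i}{\pi}\bigl\{2(\omega'\zeta-z\eta')\wp'+4(\omega'\wp-\eta')\wp-\tfrac23\omega'g_2\bigr\},\\ \mathfrak{s}\,\partial_{\omega'}\wp&=-\tfrac{i}{\pi}\bigl\{2(\omega\zeta-z\eta)\wp'+4(\omega\wp-\eta)\wp-\tfrac23\omega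 g_2\bigr\},\\ \mathfrak{s}\,\partial_\omega\wp'&=\tfrac{i}{\pi}\bigl\{6(\omega'\wp-\eta')\wp'+(\omega'\zeta-z\eta')(12\wp^2-g_2)\bigr\},\\ \mathfrak{s}\,\partial_{\omega'}\wp'&=-\tfrac{i}{\pi}\bigl\{6(\omega\wp-\eta)\wp'+(\omega\zeta-z\eta)(12\wp^2-g_2)\bigr\}. \end{aligned}$$ In particular, for $\omega=1$, $\omega'=\tau$ with $\operatorname{Im}\tau>0$ and $z\notin 2\mathbb{Z}+2\tau\mathbb{Z}$, the functions $\sigma,\zeta,\wp,\wp'$ of $(z|1,\tau)$ satisfy, with $g_2=g_2(\tau)$ and $\eta=\eta(\tau)=\zeta(1|1,\tau)$, $$\begin{aligned} \partial_\tau\sigma&=\tfrac{i}{\pi}\bigl\{\wp-\zeta^2+2\eta(z\zeta-1)-\tfrac1{12}g_2z^2\bigr\}\sigma,\\ \partial_\tau\zeta&=\tfrac{i}{\pi}\bigl\{\wp'+2(\zeta-z\eta)\wp+2\eta\zeta-\tfrac16g_2z\bigr\},\\ \partial_\tau\wp&=-\tfrac{i}{\pi}\bigl\{2(\zeta-z\eta)\wp'+4(\wp-\eta)\wp-\tfrac23g_2\bigr\},\\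 \partial_\tau\wp'&=-\tfrac{i}{\pi}\bigl\{6(\wp-\eta)\wp'+(\zeta-z\eta)(12\wp^2-g_2)\bigr\}. \end{aligned}$$ -/

import Mathlib

noncomputable section

/-- Two complex numbers whose ratio is not real are linearly independent over `ℝ`,
and so are their doubles. -/
theorem linearIndependent_two_mul_pair {ω ω' : ℂ} (h : (ω' / ω).im ≠ 0) :
    LinearIndependent ℝ ![2 * ω, 2 * ω'] := by
  have hω : ω ≠ 0 := by
    rintro rfl
    simp at h
  rw [LinearIndependent.pair_iff]
  intro s t hst
  have h1 : (s : ℂ) + t * (ω' / ω) = 0 := by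
    simp only [Complex.real_smul] at hst
    field_simp
    linear_combination hst / 2
  have h2 := congrArg Complex.im h1
  have ht : t = 0 := by
    simpa [h] using h2
  subst ht
  have h3 := congrArg Complex.re h1
  exact ⟨by simpa using h3, rfl⟩

/-- The pair of periods `(2ω, 2ω')` attached to a pair of half-periods `(ω, ω')`.
If `ω'/ω` is real (this includes `ω = 0`) the half-periods do not generate a lattice, and the
value is a placeholder, the pair `(2, 2i)`; non-real ratios form an open set, so the placeholder
plays no role in derivatives at admissible half-periods. -/
def periodsOfHalfPeriods (ω ω' : ℂ) : PeriodPair :=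
  open Classical in
  if h : (ω' / ω).im ≠ 0 then ⟨2 * ω, 2 * ω', linearIndependent_two_mul_pair h⟩
  else ⟨2 * 1, 2 * Complex.I, linearIndependent_two_mul_pair (by simp)⟩

/-- The Weierstrass function `σ(z) = z ∏_{l ≠ 0} (1 - z/l) exp(z/l + z²/(2l²))`,
the product running over the nonzero periods `l`. -/
def PeriodPair.weierstrassSigma (L : PeriodPair) (z : ℂ) : ℂ :=
  open Classical in
  z * ∏' l : L.lattice, if (l : ℂ) = 0 then 1 else
    (1 - z / (l : ℂ)) * Complex.exp (z / (l : ℂ) + z ^ 2 / (2 * (l : ℂ) ^ 2))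

/-- The Weierstrass function `ζ(z) = 1/z + ∑_{l ≠ 0} (1/(z - l) + 1/l + z/l²)`,
the sum running over the nonzero periods `l`. -/
def PeriodPair.weierstrassZeta (L : PeriodPair) (z : ℂ) : ℂ :=
  open Classical in
  1 / z + ∑' l : L.lattice, if (l : ℂ) = 0 then 0 else
    (1 / (z - (l : ℂ)) + 1 / (l : ℂ) + z / (l : ℂ) ^ 2)

/-- `σ(z | ω, ω')`. -/
def wσ (z ω ω' : ℂ) : ℂ := (periodsOfHalfPeriods ω ω').weierstrassSigma z

/-- `ζ(z | ω, ω')`. -/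
def wζ (z ω ω' : ℂ) : ℂ := (periodsOfHalfPeriods ω ω').weierstrassZeta z

/-- `℘(z | ω, ω')`. -/
def wP (z ω ω' : ℂ) : ℂ := (periodsOfHalfPeriods ω ω').weierstrassP z

/-- `℘'(z | ω, ω')`, the derivative of `℘` in `z`. -/
def wP' (z ω ω' : ℂ) : ℂ := (periodsOfHalfPeriods ω ω').derivWeierstrassP z

/-- The invariant `g₂(ω, ω') = 60 ∑_{l ≠ 0} l⁻⁴`. -/
def wg₂ (ω ω' : ℂ) : ℂ := (periodsOfHalfPeriods ω ω').g₂

/-- `η = ζ(ω | ω, ω')`. -/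
def wη (ω ω' : ℂ) : ℂ := wζ ω ω ω'

/-- `η' = ζ(ω' | ω, ω')`. -/
def wη' (ω ω' : ℂ) : ℂ := wζ ω' ω ω'

end

noncomputable section

open Filter Topology Metric

namespace PeriodPair

/-! Moving one half-period moves every period `l` to `l + t * φ l`, where `φ` is real-linear and
fixed by its values on the two basic periods. This is holomorphic in `t`, and the terms of the
series for ζ, ℘, ℘' and of the product for σ are `O(|l|⁻³)` uniformly for small `t`, so all four can
be differentiated in `t` term by term. The results are the series `deformSigma` (for log σ),
`deformZeta`, `deformP`, `deformDerivP`. Up to sign each is the z-derivative of the one before, and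
all are linear in `φ`. The pairs of values on the basic periods form a complex plane, so two
independent choices of `φ` suffice.

The first choice is the identity, an infinitesimal scaling, where Euler's homogeneity relation gives
the answer (`deformSigma_id`). The second sends each basic period ω to the quasi-period 2ζ(ω/2).
Translation by ω changes `deformP` by −φ(ω)℘' (`deformP_add`), and this is exactly compensated by
the change of ζ℘'. Hence `deformP` + ζ℘' + 2℘² − g₂/3 is elliptic; it tends to zero at the origin,
so it vanishes by Liouville's theorem (`IsQuasiPeriodMap.deformP_eq`). Integrating in z gives the
formulas for ζ and log σ, differentiating gives that for ℘'.

Legendre's relation (`legendre_relation`) says that (ω, ω') and (η, η') are independent, with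
determinant ±πi/2. Solving for the deformations (2, 0) and (0, 2) by Cramer's rule brings in the
factor i/π and the sign 𝔰. -/

/-! ### Uniform separation of deformed periods and termwise differentiation -/

theorem summable_norm_inv_pow_three (L : PeriodPair) :
    Summable fun l : L.lattice => ‖(l : ℂ)‖⁻¹ ^ 3 :=
  ZLattice.summable_norm_pow_inv L.lattice 3 (by simp)

/-- Near a point which is not a nonzero period, and for small deformations `l + t * φ l` of the
periods, the nonzero periods stay away from the point, uniformly relative to their size. -/
theorem exists_deformed_lattice_bounds (L : PeriodPair) (φ : ℂ →L[ℝ] ℂ) {z₀ : ℂ}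
    (hz₀ : z₀ ∈ ((L.lattice : Set ℂ) \ {0})ᶜ) :
    ∃ ε > 0, ∃ d > 0, ∀ z ∈ ball z₀ ε, ‖z‖ ≤ d ∧ ∀ t ∈ ball (0 : ℂ) ε, ∀ l ∈ L.lattice, l ≠ 0 →
      z - (l + t * φ l) ≠ 0 ∧ l + t * φ l ≠ 0 ∧ ‖(z - (l + t * φ l))⁻¹‖ ≤ d * ‖l‖⁻¹ ∧
      ‖(l + t * φ l)⁻¹‖ ≤ d * ‖l‖⁻¹ ∧ ‖l‖⁻¹ ≤ d := by
  have hopen : IsOpen ((L.lattice : Set ℂ) \ {0})ᶜ := L.isOpen_compl_lattice_sdiff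
  obtain ⟨δ₁, hδ₁, h₁⟩ := Metric.isOpen_iff.mp hopen z₀ hz₀
  obtain ⟨δ₂, hδ₂, h₂⟩ := Metric.isOpen_iff.mp hopen 0 (by simp)
  have hl₁ : ∀ l ∈ L.lattice, l ≠ 0 → δ₁ ≤ ‖z₀ - l‖ := by
    intro l hl hl0
    by_contra! h
    exact h₁ (by rwa [mem_ball, dist_comm, dist_eq_norm]) ⟨hl, hl0⟩
  have hl₂ : ∀ l ∈ L.lattice, l ≠ 0 → δ₂ ≤ ‖l‖ := by
    intro l hl hl0
    by_contra! h
    exact h₂ (by rwa [mem_ball, dist_zero_right]) ⟨hl, hl0⟩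
  -- The constant in |z₀ − l| ≥ c|l|: the value 1/2 serves periods with |l| ≥ 2|z₀|, and the gap δ₁
  -- serves the remaining bounded ones.
  set c : ℝ := min (1 / 2) (δ₁ / (2 * ‖z₀‖ + 1)) with hc
  have hc0 : 0 < c := by positivity
  have hc1 : c ≤ 1 / 2 := min_le_left _ _
  have hsep : ∀ l ∈ L.lattice, l ≠ 0 → c * ‖l‖ ≤ ‖z₀ - l‖ := by
    intro l hl hl0
    rcases le_total (2 * ‖z₀‖) ‖l‖ with h | h
    · have := norm_sub_norm_le l z₀
      rw [norm_sub_rev] at this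
      nlinarith [norm_nonneg l]
    · calc c * ‖l‖ ≤ δ₁ / (2 * ‖z₀‖ + 1) * (2 * ‖z₀‖ + 1) := by
            gcongr
            · exact min_le_right _ _
            · linarith
        _ = δ₁ := by field_simp
        _ ≤ _ := hl₁ l hl hl0
  -- Moving z by ε and l by tφ(l) must together cost at most half of the separation c|l|. The move
  -- of z is absorbed through 1 ≤ δ₂⁻¹|l|, that of l through ‖φ‖.
  set ε : ℝ := c / 2 / (δ₂⁻¹ + ‖φ‖ + 1) with hε
  have hε0 : 0 < ε := by positivity
  refine ⟨ε, hε0, max (max (2 / c) (‖z₀‖ + ε)) δ₂⁻¹, by positivity, fun z hz => ⟨?_, ?_⟩⟩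
  · refine le_trans ?_ ((le_max_right _ _).trans (le_max_left _ _))
    rw [mem_ball, dist_eq_norm] at hz
    have := norm_sub_norm_le z z₀
    linarith
  intro t ht l hl hl0
  rw [mem_ball, dist_eq_norm] at hz
  rw [mem_ball, dist_zero_right] at ht
  have hn : 0 < ‖l‖ := norm_pos_iff.mpr hl0
  have hpert : ε + ‖t * φ l‖ ≤ c / 2 * ‖l‖ := by
    have e1 : ‖t * φ l‖ ≤ ε * (‖φ‖ * ‖l‖) := by
      rw [norm_mul]
      gcongr
      exact φ.le_opNorm l
    have e2 : ε * 1 ≤ ε * (δ₂⁻¹ * ‖l‖) := by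
      gcongr
      rw [inv_mul_eq_div, le_div_iff₀ hδ₂, one_mul]
      exact hl₂ l hl hl0
    have e3 : ε * (δ₂⁻¹ + ‖φ‖ + 1) = c / 2 := by
      rw [hε]; field_simp
    rw [← e3]
    nlinarith
  have hA : c / 2 * ‖l‖ ≤ ‖z - (l + t * φ l)‖ := by
    have e1 := hsep l hl hl0
    have e2 : ‖z₀ - l‖ ≤ ‖z - (l + t * φ l)‖ + ‖z - z₀‖ + ‖t * φ l‖ := by
      calc ‖z₀ - l‖ = ‖(z - (l + t * φ l)) - (z - z₀) + t * φ l‖ := by congr 1; ring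
        _ ≤ _ := (norm_add_le _ _).trans (by gcongr; exact norm_sub_le _ _)
    linarith
  have hB : c / 2 * ‖l‖ ≤ ‖l + t * φ l‖ := by
    have e2 : ‖l‖ ≤ ‖l + t * φ l‖ + ‖t * φ l‖ := by
      calc ‖l‖ = ‖(l + t * φ l) - t * φ l‖ := by congr 1; ring
        _ ≤ _ := norm_sub_le _ _
    nlinarith
  have key : ∀ w : ℂ, c / 2 * ‖l‖ ≤ ‖w‖ → w ≠ 0 ∧
      ‖w⁻¹‖ ≤ max (max (2 / c) (‖z₀‖ + ε)) δ₂⁻¹ * ‖l‖⁻¹ := by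
    intro w hw
    have hw0 : 0 < ‖w‖ := lt_of_lt_of_le (by positivity) hw
    refine ⟨norm_pos_iff.mp hw0, ?_⟩
    calc ‖w⁻¹‖ = ‖w‖⁻¹ := norm_inv w
      _ ≤ (c / 2 * ‖l‖)⁻¹ := by gcongr
      _ = 2 / c * ‖l‖⁻¹ := by field_simp
      _ ≤ _ := by gcongr; exact (le_max_left _ _).trans (le_max_left _ _)
  refine ⟨(key _ hA).1, (key _ hB).1, (key _ hA).2, (key _ hB).2, ?_⟩
  refine le_trans ?_ (le_max_right _ _)
  gcongr
  exact hl₂ l hl hl0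

/-- Termwise differentiation of a series over the lattice whose terms are `O(|l|⁻³)` uniformly. -/
theorem hasDerivAt_tsum_lattice (L : PeriodPair) {F F' : L.lattice → ℂ → ℂ} {x : ℂ} {ε K : ℝ}
    (hε : 0 < ε) (hF : ∀ l, ∀ w ∈ ball x ε, HasDerivAt (F l) (F' l w) w)
    (hb : ∀ l, ∀ w ∈ ball x ε, ‖F l w‖ ≤ K * ‖(l : ℂ)‖⁻¹ ^ 3) :
    HasSum (F · x) (∑' l, F l x) ∧ HasSum (F' · x) (∑' l, F' l x) ∧
      HasDerivAt (fun w => ∑' l, F l w) (∑' l, F' l x) x := by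
  have hx : x ∈ ball x ε := mem_ball_self hε
  have hs : Summable fun l : L.lattice => K * ‖(l : ℂ)‖⁻¹ ^ 3 :=
    L.summable_norm_inv_pow_three.mul_left K
  have hd : ∀ l, DifferentiableOn ℂ (F l) (ball x ε) := fun l w hw =>
    (hF l w hw).differentiableAt.differentiableWithinAt
  have h1 := Complex.hasSum_deriv_of_summable_norm hs hd isOpen_ball hb hx
  have h2 := (Complex.differentiableOn_tsum_of_summable_norm hs hd isOpen_ball hb).differentiableAt
    (isOpen_ball.mem_nhds hx)
  have h3 : (fun l => deriv (F l) x) = fun l => F' l x := funext fun l => (hF l x hx).deriv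
  rw [h3] at h1
  refine ⟨(Summable.of_norm_bounded hs fun l => hb l x hx).hasSum, h1.summable.hasSum, ?_⟩
  rw [h1.tsum_eq]
  exact h2.hasDerivAt

/-! ### Cubic decay of the individual terms -/

section TermBounds

variable {z l p : ℂ} {d n C : ℝ}

/-- Here `n` plays the role of |l|⁻¹. Each bound below comes from writing a term as a combination of
these monomials with i + j ≥ 3. -/
theorem norm_inv_mul_inv_le (hd : 0 ≤ d) (hu : ‖(z - l)⁻¹‖ ≤ d * n) (hv : ‖l⁻¹‖ ≤ d * n)
    (hz : ‖z‖ ≤ d) (i j k : ℕ) :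
    ‖z ^ k * ((z - l)⁻¹ ^ i * l⁻¹ ^ j)‖ ≤ d ^ k * (d * n) ^ (i + j) := by
  have : 0 ≤ d * n := (norm_nonneg _).trans hu
  rw [norm_mul, norm_mul, norm_pow, norm_pow, norm_pow, pow_add]
  gcongr

theorem norm_weierstrassP_term_le (hd : 0 ≤ d) (h0 : z - l ≠ 0) (h1 : l ≠ 0)
    (hu : ‖(z - l)⁻¹‖ ≤ d * n) (hv : ‖l⁻¹‖ ≤ d * n) (hz : ‖z‖ ≤ d) :
    ‖1 / (z - l) ^ 2 - 1 / l ^ 2‖ ≤ 2 * d ^ 4 * n ^ 3 := by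
  have e : 1 / (z - l) ^ 2 - 1 / l ^ 2 =
      z ^ 1 * ((z - l)⁻¹ ^ 2 * l⁻¹ ^ 1) - z ^ 1 * ((z - l)⁻¹ ^ 1 * l⁻¹ ^ 2) := by
    field_simp
    ring
  have b1 := norm_inv_mul_inv_le hd hu hv hz 2 1 1
  have b2 := norm_inv_mul_inv_le hd hu hv hz 1 2 1
  rw [e]
  refine (norm_sub_le _ _).trans ((add_le_add b1 b2).trans_eq ?_)
  ring

theorem norm_weierstrassZeta_term_le (hd : 0 ≤ d) (h0 : z - l ≠ 0) (h1 : l ≠ 0)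
    (hu : ‖(z - l)⁻¹‖ ≤ d * n) (hv : ‖l⁻¹‖ ≤ d * n) (hz : ‖z‖ ≤ d) :
    ‖1 / (z - l) + 1 / l + z / l ^ 2‖ ≤ d ^ 5 * n ^ 3 := by
  have e : 1 / (z - l) + 1 / l + z / l ^ 2 = z ^ 2 * ((z - l)⁻¹ ^ 1 * l⁻¹ ^ 2) := by
    field_simp
    ring
  rw [e]
  exact (norm_inv_mul_inv_le hd hu hv hz 1 2 2).trans_eq (by ring)

theorem norm_derivWeierstrassP_term_le (hd : 0 ≤ d) (hu : ‖(z - l)⁻¹‖ ≤ d * n)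
    (hv : ‖l⁻¹‖ ≤ d * n) (hz : ‖z‖ ≤ d) :
    ‖-2 / (z - l) ^ 3‖ ≤ 2 * d ^ 3 * n ^ 3 := by
  have e : -2 / (z - l) ^ 3 = -2 * (z ^ 0 * ((z - l)⁻¹ ^ 3 * l⁻¹ ^ 0)) := by
    simp [div_eq_mul_inv]
  have b := norm_inv_mul_inv_le hd hu hv hz 3 0 0
  rw [e, norm_mul]
  simp only [norm_neg, Complex.norm_ofNat]
  linarith

/-- In this and the next two bounds `p` stands for `φ l`, which may grow like |l|. The other factor
therefore has to decay to fourth order, and one power is spent on `p`. -/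
theorem norm_deformSigma_term_le (hd : 0 ≤ d) (h0 : z - l ≠ 0) (h1 : l ≠ 0)
    (hu : ‖(z - l)⁻¹‖ ≤ d * n) (hv : ‖l⁻¹‖ ≤ d * n) (hz : ‖z‖ ≤ d) (hp : ‖p‖ * n ≤ C)
    (hn : 0 ≤ n) :
    ‖p * (z ^ 3 / (l ^ 3 * (l - z)))‖ ≤ C * d ^ 7 * n ^ 3 := by
  have h0' : l - z ≠ 0 := by rwa [← neg_sub, neg_ne_zero]
  have e : z ^ 3 / (l ^ 3 * (l - z)) = -(z ^ 3 * ((z - l)⁻¹ ^ 1 * l⁻¹ ^ 3)) := by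
    rw [show l - z = -(z - l) by ring]
    field_simp
  have b := norm_inv_mul_inv_le hd hu hv hz 1 3 3
  rw [e, norm_mul, norm_neg]
  calc _ ≤ ‖p‖ * (d ^ 3 * (d * n) ^ (1 + 3)) := by gcongr
    _ = (‖p‖ * n) * (d ^ 7 * n ^ 3) := by ring
    _ ≤ C * (d ^ 7 * n ^ 3) := by gcongr
    _ = _ := by ring

theorem norm_deformZeta_term_le (hd : 0 ≤ d) (h0 : z - l ≠ 0) (h1 : l ≠ 0)
    (hu : ‖(z - l)⁻¹‖ ≤ d * n) (hv : ‖l⁻¹‖ ≤ d * n) (hz : ‖z‖ ≤ d) (hp : ‖p‖ * n ≤ C)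
    (hn : 0 ≤ n) :
    ‖p * (1 / (z - l) ^ 2 - 1 / l ^ 2 - 2 * z / l ^ 3)‖ ≤ 3 * C * d ^ 6 * n ^ 3 := by
  have e : 1 / (z - l) ^ 2 - 1 / l ^ 2 - 2 * z / l ^ 3 =
      z ^ 2 * ((z - l)⁻¹ ^ 2 * l⁻¹ ^ 2) - 2 * (z ^ 2 * ((z - l)⁻¹ ^ 1 * l⁻¹ ^ 3)) := by
    field_simp
    ring
  have b1 := norm_inv_mul_inv_le hd hu hv hz 2 2 2
  have b2 := norm_inv_mul_inv_le hd hu hv hz 1 3 2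
  have b : ‖1 / (z - l) ^ 2 - 1 / l ^ 2 - 2 * z / l ^ 3‖ ≤ 3 * d ^ 6 * n ^ 4 := by
    rw [e]
    refine (norm_sub_le _ _).trans ?_
    rw [norm_mul 2, Complex.norm_ofNat]
    linarith
  rw [norm_mul]
  calc _ ≤ ‖p‖ * (3 * d ^ 6 * n ^ 4) := by gcongr
    _ = (‖p‖ * n) * (3 * d ^ 6 * n ^ 3) := by ring
    _ ≤ C * (3 * d ^ 6 * n ^ 3) := by gcongr
    _ = _ := by ring

theorem norm_deformP_term_le (hd : 0 ≤ d) (h0 : z - l ≠ 0) (h1 : l ≠ 0)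
    (hu : ‖(z - l)⁻¹‖ ≤ d * n) (hv : ‖l⁻¹‖ ≤ d * n) (hz : ‖z‖ ≤ d) (hp : ‖p‖ * n ≤ C)
    (hn : 0 ≤ n) :
    ‖2 * p * (1 / (z - l) ^ 3 + 1 / l ^ 3)‖ ≤ 6 * C * d ^ 5 * n ^ 3 := by
  have e : 1 / (z - l) ^ 3 + 1 / l ^ 3 =
      z ^ 1 * ((z - l)⁻¹ ^ 3 * l⁻¹ ^ 1) - z ^ 1 * ((z - l)⁻¹ ^ 2 * l⁻¹ ^ 2)
        + z ^ 1 * ((z - l)⁻¹ ^ 1 * l⁻¹ ^ 3) := by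
    field_simp
    ring
  have b1 := norm_inv_mul_inv_le hd hu hv hz 3 1 1
  have b2 := norm_inv_mul_inv_le hd hu hv hz 2 2 1
  have b3 := norm_inv_mul_inv_le hd hu hv hz 1 3 1
  have b : ‖1 / (z - l) ^ 3 + 1 / l ^ 3‖ ≤ 3 * d ^ 5 * n ^ 4 := by
    rw [e]
    refine (norm_add_le _ _).trans ((add_le_add_left (norm_sub_le _ _) _).trans ?_)
    linarith
  rw [norm_mul, norm_mul, Complex.norm_ofNat]
  calc _ ≤ 2 * ‖p‖ * (3 * d ^ 5 * n ^ 4) := by gcongr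
    _ = (‖p‖ * n) * (6 * d ^ 5 * n ^ 3) := by ring
    _ ≤ C * (6 * d ^ 5 * n ^ 3) := by gcongr
    _ = _ := by ring

end TermBounds

/-! ### Deformation series and their z-derivatives -/

/-- The regular part `ζ(z) - 1/z` of the Weierstrass zeta function at the origin. -/
def weierstrassZetaExcept (L : PeriodPair) (z : ℂ) : ℂ :=
  ∑' l : L.lattice, if (l : ℂ) = 0 then 0 else
    (1 / (z - (l : ℂ)) + 1 / (l : ℂ) + z / (l : ℂ) ^ 2)

/-- The derivative of `log σ` along the deformation `l ↦ l + t * φ l` of the periods. -/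
def deformSigma (L : PeriodPair) (φ : ℂ →L[ℝ] ℂ) (z : ℂ) : ℂ :=
  ∑' l : L.lattice, φ l * (z ^ 3 / ((l : ℂ) ^ 3 * (l - z)))

/-- The derivative of `ζ` along the deformation `l ↦ l + t * φ l` of the periods. -/
def deformZeta (L : PeriodPair) (φ : ℂ →L[ℝ] ℂ) (z : ℂ) : ℂ :=
  ∑' l : L.lattice, φ l * (1 / (z - l) ^ 2 - 1 / (l : ℂ) ^ 2 - 2 * z / (l : ℂ) ^ 3)

/-- The derivative of `℘` along the deformation `l ↦ l + t * φ l` of the periods. -/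
def deformP (L : PeriodPair) (φ : ℂ →L[ℝ] ℂ) (z : ℂ) : ℂ :=
  ∑' l : L.lattice, 2 * φ l * (1 / (z - l) ^ 3 + 1 / (l : ℂ) ^ 3)

/-- The derivative of `℘'` along the deformation `l ↦ l + t * φ l` of the periods. -/
def deformDerivP (L : PeriodPair) (φ : ℂ →L[ℝ] ℂ) (z : ℂ) : ℂ :=
  ∑' l : L.lattice, -6 * φ l / (z - l) ^ 4

theorem weierstrassZeta_eq (L : PeriodPair) (z : ℂ) :
    L.weierstrassZeta z = 1 / z + L.weierstrassZetaExcept z := by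
  simp only [weierstrassZeta, weierstrassZetaExcept]

theorem weierstrassP_eq (L : PeriodPair) (z : ℂ) :
    L.weierstrassP z = 1 / z ^ 2 + L.weierstrassPExcept 0 z := by
  have := L.weierstrassPExcept_add 0 z
  simp at this
  rw [← this]
  ring

theorem derivWeierstrassP_eq (L : PeriodPair) (z : ℂ) :
    L.derivWeierstrassP z = -2 / z ^ 3 + L.derivWeierstrassPExcept 0 z := by
  have := L.derivWeierstrassPExcept_sub 0 z
  simp at this
  rw [← this]
  ring

theorem exists_lattice_bounds (L : PeriodPair) {z₀ : ℂ}
    (hz₀ : z₀ ∈ ((L.lattice : Set ℂ) \ {0})ᶜ) :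
    ∃ ε > 0, ∃ d > 0, ∀ z ∈ ball z₀ ε, ‖z‖ ≤ d ∧ ∀ l ∈ L.lattice, l ≠ 0 →
      z - l ≠ 0 ∧ ‖(z - l)⁻¹‖ ≤ d * ‖l‖⁻¹ ∧ ‖l⁻¹‖ ≤ d * ‖l‖⁻¹ := by
  obtain ⟨ε, hε, d, hd, h⟩ := L.exists_deformed_lattice_bounds 0 hz₀
  refine ⟨ε, hε, d, hd, fun z hz => ⟨(h z hz).1, fun l hl hl0 => ?_⟩⟩
  have := (h z hz).2 0 (mem_ball_self hε) l hl hl0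
  simp only [zero_mul, add_zero] at this
  exact ⟨this.1, this.2.2.1, this.2.2.2.1⟩

theorem norm_apply_mul_inv_le (φ : ℂ →L[ℝ] ℂ) {l : ℂ} (hl : l ≠ 0) : ‖φ l‖ * ‖l‖⁻¹ ≤ ‖φ‖ := by
  rw [← div_eq_mul_inv, div_le_iff₀ (norm_pos_iff.mpr hl)]
  exact φ.le_opNorm l

theorem hasDerivAt_weierstrassZetaExcept (L : PeriodPair) {z : ℂ}
    (hz : z ∈ ((L.lattice : Set ℂ) \ {0})ᶜ) :
    HasDerivAt L.weierstrassZetaExcept (-L.weierstrassPExcept 0 z) z := by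
  obtain ⟨ε, hε, d, hd, h⟩ := L.exists_lattice_bounds hz
  have key := (L.hasDerivAt_tsum_lattice (x := z) (K := d ^ 5) hε
    (F := fun l w => if (l : ℂ) = 0 then 0 else (1 / (w - l) + 1 / (l : ℂ) + w / (l : ℂ) ^ 2))
    (F' := fun l w => -(if (l : ℂ) = 0 then 0 else (1 / (w - l) ^ 2 - 1 / (l : ℂ) ^ 2)))
    ?_ ?_).2.2
  · rw [tsum_neg] at key
    exact key
  · intro l w hw
    split_ifs with hl
    · simpa using hasDerivAt_const w (0 : ℂ)
    · have hne := ((h w hw).2 l l.2 hl).1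
      convert! ((((hasDerivAt_id w).sub_const (l : ℂ)).fun_inv hne).add_const
        (1 / (l : ℂ))).add ((hasDerivAt_id w).div_const ((l : ℂ) ^ 2)) using 1
      · ext; simp
      · simp; ring
  · intro l w hw
    split_ifs with hl
    · rw [norm_zero]; positivity
    · obtain ⟨h1, h2, h3⟩ := (h w hw).2 l l.2 hl
      exact norm_weierstrassZeta_term_le hd.le h1 hl h2 h3 (h w hw).1

/-- Differentiation in z commutes with the deformation, so the relations (log σ)' = ζ, ζ' = −℘ pass
to the deformation series. The point z = 0 is allowed because the term at l = 0 carries φ(0) = 0;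
this later fixes constants of integration. -/
theorem hasSum_deformSigma_and_hasDerivAt (L : PeriodPair) (φ : ℂ →L[ℝ] ℂ) {z : ℂ}
    (hz : z ∈ ((L.lattice : Set ℂ) \ {0})ᶜ) :
    HasSum (fun l : L.lattice => φ l * (z ^ 3 / ((l : ℂ) ^ 3 * (l - z)))) (L.deformSigma φ z) ∧
      HasDerivAt (L.deformSigma φ) (L.deformZeta φ z) z := by
  obtain ⟨ε, hε, d, hd, h⟩ := L.exists_lattice_bounds hz
  have key := L.hasDerivAt_tsum_lattice (x := z) (K := ‖φ‖ * d ^ 7) hε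
    (F := fun l w => φ l * (w ^ 3 / ((l : ℂ) ^ 3 * (l - w))))
    (F' := fun l w => φ l * (1 / (w - l) ^ 2 - 1 / (l : ℂ) ^ 2 - 2 * w / (l : ℂ) ^ 3))
    ?_ ?_
  · exact ⟨key.1, key.2.2⟩
  · intro l w hw
    rcases eq_or_ne (l : ℂ) 0 with hl | hl
    · simpa [hl] using hasDerivAt_const w (0 : ℂ)
    · have hne := ((h w hw).2 l l.2 hl).1
      have hne' : (l : ℂ) - w ≠ 0 := by rwa [← neg_sub, neg_ne_zero]
      refine HasDerivAt.const_mul _ ?_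
      convert! ((hasDerivAt_id w).fun_pow 3).fun_div
        (((hasDerivAt_id w).const_sub (l : ℂ)).const_mul ((l : ℂ) ^ 3))
        (mul_ne_zero (pow_ne_zero 3 hl) hne') using 1
      simp only [id]
      rw [show w - (l : ℂ) = -(l - w) by ring]
      field_simp
      push_cast
      ring
  · intro l w hw
    rcases eq_or_ne (l : ℂ) 0 with hl | hl
    · simp [hl]
    · obtain ⟨h1, h2, h3⟩ := (h w hw).2 l l.2 hl
      exact norm_deformSigma_term_le hd.le h1 hl h2 h3 (h w hw).1
        (norm_apply_mul_inv_le φ hl) (by positivity)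

theorem hasSum_deformZeta_and_hasDerivAt (L : PeriodPair) (φ : ℂ →L[ℝ] ℂ) {z : ℂ}
    (hz : z ∈ ((L.lattice : Set ℂ) \ {0})ᶜ) :
    HasSum (fun l : L.lattice =>
      φ l * (1 / (z - l) ^ 2 - 1 / (l : ℂ) ^ 2 - 2 * z / (l : ℂ) ^ 3)) (L.deformZeta φ z) ∧
      HasDerivAt (L.deformZeta φ) (-L.deformP φ z) z := by
  obtain ⟨ε, hε, d, hd, h⟩ := L.exists_lattice_bounds hz
  have key := L.hasDerivAt_tsum_lattice (x := z) (K := 3 * ‖φ‖ * d ^ 6) hε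
    (F := fun l w => φ l * (1 / (w - l) ^ 2 - 1 / (l : ℂ) ^ 2 - 2 * w / (l : ℂ) ^ 3))
    (F' := fun l w => -(2 * φ l * (1 / (w - l) ^ 3 + 1 / (l : ℂ) ^ 3)))
    ?_ ?_
  · rw [tsum_neg] at key
    exact ⟨key.1, key.2.2⟩
  · intro l w hw
    rcases eq_or_ne (l : ℂ) 0 with hl | hl
    · simpa [hl] using hasDerivAt_const w (0 : ℂ)
    · have hne := ((h w hw).2 l l.2 hl).1
      have := (((((hasDerivAt_id w).sub_const (l : ℂ)).fun_pow 2).fun_inv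
        (pow_ne_zero 2 hne)).sub_const (1 / (l : ℂ) ^ 2)).fun_sub
        (((hasDerivAt_id w).const_mul 2).div_const ((l : ℂ) ^ 3))
      convert! this.const_mul (φ l) using 1
      · ext; simp
      · simp only [id]
        field_simp
        push_cast
        ring
  · intro l w hw
    rcases eq_or_ne (l : ℂ) 0 with hl | hl
    · simp [hl]
    · obtain ⟨h1, h2, h3⟩ := (h w hw).2 l l.2 hl
      exact norm_deformZeta_term_le hd.le h1 hl h2 h3 (h w hw).1
        (norm_apply_mul_inv_le φ hl) (by positivity)

theorem hasSum_deformP_and_hasDerivAt (L : PeriodPair) (φ : ℂ →L[ℝ] ℂ) {z : ℂ}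
    (hz : z ∈ ((L.lattice : Set ℂ) \ {0})ᶜ) :
    HasSum (fun l : L.lattice =>
      2 * φ l * (1 / (z - l) ^ 3 + 1 / (l : ℂ) ^ 3)) (L.deformP φ z) ∧
      HasSum (fun l : L.lattice => -6 * φ l / (z - l) ^ 4) (L.deformDerivP φ z) ∧
      HasDerivAt (L.deformP φ) (L.deformDerivP φ z) z := by
  obtain ⟨ε, hε, d, hd, h⟩ := L.exists_lattice_bounds hz
  refine L.hasDerivAt_tsum_lattice (x := z) (K := 6 * ‖φ‖ * d ^ 5) hε
    (F := fun l w => 2 * φ l * (1 / (w - l) ^ 3 + 1 / (l : ℂ) ^ 3))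
    (F' := fun l w => -6 * φ l / (w - l) ^ 4)
    ?_ ?_
  · intro l w hw
    rcases eq_or_ne (l : ℂ) 0 with hl | hl
    · simpa [hl] using hasDerivAt_const w (0 : ℂ)
    · have hne := ((h w hw).2 l l.2 hl).1
      have := ((((hasDerivAt_id w).sub_const (l : ℂ)).fun_pow 3).fun_inv
        (pow_ne_zero 3 hne)).add_const (1 / (l : ℂ) ^ 3)
      convert! this.const_mul (2 * φ l) using 1
      · ext; simp
      · simp only [id]
        field_simp
        push_cast
        ring
  · intro l w hw
    rcases eq_or_ne (l : ℂ) 0 with hl | hl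
    · simp [hl]
    · obtain ⟨h1, h2, h3⟩ := (h w hw).2 l l.2 hl
      exact norm_deformP_term_le hd.le h1 hl h2 h3 (h w hw).1
        (norm_apply_mul_inv_le φ hl) (by positivity)

/-! ### Differentiation along a deformation of the lattice -/

/-- `M` is the period pair obtained from `L` by the deformation `l ↦ l + t * φ l`. -/
def IsDeformation (L M : PeriodPair) (φ : ℂ →L[ℝ] ℂ) (t : ℂ) : Prop :=
  M.ω₁ = L.ω₁ + t * φ L.ω₁ ∧ M.ω₂ = L.ω₂ + t * φ L.ω₂

/-- The identification of two period lattices which matches the given bases. -/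
def latticeEquiv (L M : PeriodPair) : L.lattice ≃ M.lattice :=
  (L.latticeEquivProd.trans M.latticeEquivProd.symm).toEquiv

theorem apply_coe_lattice (L : PeriodPair) (φ : ℂ →L[ℝ] ℂ) (l : L.lattice) :
    φ l = (L.latticeEquivProd l).1 * φ L.ω₁ + (L.latticeEquivProd l).2 * φ L.ω₂ := by
  have h := L.latticeEquiv_symm_apply (L.latticeEquivProd l)
  rw [LinearEquiv.symm_apply_apply] at h
  rw [h]
  simp only [← zsmul_eq_mul, map_add, map_zsmul]

theorem coe_latticeEquiv {L M : PeriodPair} {φ : ℂ →L[ℝ] ℂ} {t : ℂ} (h : L.IsDeformation M φ t)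
    (l : L.lattice) : (L.latticeEquiv M l : ℂ) = l + t * φ l := by
  have h1 : (L.latticeEquiv M l : ℂ) =
      (L.latticeEquivProd l).1 * M.ω₁ + (L.latticeEquivProd l).2 * M.ω₂ :=
    M.latticeEquiv_symm_apply _
  have h2 := L.latticeEquiv_symm_apply (L.latticeEquivProd l)
  rw [LinearEquiv.symm_apply_apply] at h2
  rw [h1, h.1, h.2, L.apply_coe_lattice φ l]
  linear_combination -h2

theorem coe_latticeEquiv_eq_zero_iff {L M : PeriodPair} (l : L.lattice) :
    (L.latticeEquiv M l : ℂ) = 0 ↔ (l : ℂ) = 0 := by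
  rw [ZeroMemClass.coe_eq_zero, ZeroMemClass.coe_eq_zero]
  exact (L.latticeEquivProd.trans M.latticeEquivProd.symm).map_eq_zero_iff

/-- The index set of the sum varies with the lattice. Transport along `latticeEquiv` puts all nearby
lattices on one fixed index set, which termwise differentiation requires. -/
theorem tsum_deformation {L M : PeriodPair} {φ : ℂ →L[ℝ] ℂ} {t : ℂ} (h : L.IsDeformation M φ t)
    (f : ℂ → ℂ) : (∑' l : M.lattice, if (l : ℂ) = 0 then 0 else f l) =
      ∑' l : L.lattice, if (l : ℂ) = 0 then 0 else f (l + t * φ l) := by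
  rw [← (L.latticeEquiv M).tsum_eq]
  simp only [coe_latticeEquiv_eq_zero_iff]
  simp only [coe_latticeEquiv h]

theorem tprod_deformation {L M : PeriodPair} {φ : ℂ →L[ℝ] ℂ} {t : ℂ} (h : L.IsDeformation M φ t)
    (f : ℂ → ℂ) : (∏' l : M.lattice, if (l : ℂ) = 0 then 1 else f l) =
      ∏' l : L.lattice, if (l : ℂ) = 0 then 1 else f (l + t * φ l) := by
  rw [← (L.latticeEquiv M).tprod_eq]
  simp only [coe_latticeEquiv_eq_zero_iff]
  simp only [coe_latticeEquiv h]

theorem hasDerivAt_line (l p t : ℂ) : HasDerivAt (fun t : ℂ => l + t * p) p t := by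
  simpa using ((hasDerivAt_id t).mul_const p).const_add l

/-- A function of a complex variable `w` which near `w₀` equals `f (w - w₀)`. -/
theorem hasDerivAt_of_eventuallyEq_sub {f g : ℂ → ℂ} {g' w₀ : ℂ} (hg : HasDerivAt g g' 0)
    (h : ∀ᶠ w in 𝓝 w₀, f w = g (w - w₀)) : HasDerivAt f g' w₀ := by
  rw [← sub_self w₀] at hg
  exact (hg.comp_sub_const w₀ w₀).congr_of_eventuallyEq h

section

variable {L : PeriodPair} {φ : ℂ →L[ℝ] ℂ} {M : ℂ → PeriodPair} {w₀ z : ℂ}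

theorem hasDerivAt_weierstrassP_deformation
    (hM : ∀ᶠ w in 𝓝 w₀, L.IsDeformation (M w) φ (w - w₀)) (hz : z ∉ L.lattice) :
    HasDerivAt (fun w => (M w).weierstrassP z) (L.deformP φ z) w₀ := by
  obtain ⟨ε, hε, d, hd, h⟩ := L.exists_deformed_lattice_bounds φ (z₀ := z) (fun hz' => hz hz'.1)
  obtain ⟨hzd, h⟩ := h z (mem_ball_self hε)
  have key := (L.hasDerivAt_tsum_lattice (x := 0) (K := 2 * d ^ 4) hε
    (F := fun l t => if (l : ℂ) = 0 then 0 else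
      (1 / (z - (l + t * φ l)) ^ 2 - 1 / ((l : ℂ) + t * φ l) ^ 2))
    (F' := fun l t => 2 * φ l * (1 / (z - (l + t * φ l)) ^ 3 + 1 / ((l : ℂ) + t * φ l) ^ 3))
    ?_ ?_).2.2
  · refine hasDerivAt_of_eventuallyEq_sub (g := fun t => 1 / z ^ 2 + ∑' l : L.lattice,
      if (l : ℂ) = 0 then 0 else
      (1 / (z - (l + t * φ l)) ^ 2 - 1 / ((l : ℂ) + t * φ l) ^ 2)) ?_ ?_
    · convert! key.const_add (1 / z ^ 2) using 1
      simp [deformP]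
    · filter_upwards [hM] with w hw
      rw [weierstrassP_eq, weierstrassPExcept,
        tsum_deformation hw (fun l => 1 / (z - l) ^ 2 - 1 / l ^ 2)]
  · intro l t ht
    split_ifs with hl
    · simpa [hl] using hasDerivAt_const t (0 : ℂ)
    · obtain ⟨h1, h2, -⟩ := h t ht l l.2 hl
      have := ((((hasDerivAt_line (l : ℂ) (φ l) t).const_sub z).fun_pow 2).fun_inv
        (pow_ne_zero 2 h1)).fun_sub
        (((hasDerivAt_line (l : ℂ) (φ l) t).fun_pow 2).fun_inv (pow_ne_zero 2 h2))
      convert! this using 1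
      · ext; simp
      · generalize (l : ℂ) + t * φ l = q at *
        generalize z - q = u at *
        simp only [Nat.cast_ofNat, Nat.reduceSub, pow_one]
        field_simp
        ring
  · intro l t ht
    split_ifs with hl
    · rw [norm_zero]; positivity
    · obtain ⟨h1, h2, h3, h4, -⟩ := h t ht l l.2 hl
      exact norm_weierstrassP_term_le hd.le h1 h2 h3 h4 hzd

theorem hasDerivAt_derivWeierstrassP_deformation
    (hM : ∀ᶠ w in 𝓝 w₀, L.IsDeformation (M w) φ (w - w₀)) (hz : z ∉ L.lattice) :
    HasDerivAt (fun w => (M w).derivWeierstrassP z) (L.deformDerivP φ z) w₀ := by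
  obtain ⟨ε, hε, d, hd, h⟩ := L.exists_deformed_lattice_bounds φ (z₀ := z) (fun hz' => hz hz'.1)
  obtain ⟨hzd, h⟩ := h z (mem_ball_self hε)
  have key := (L.hasDerivAt_tsum_lattice (x := 0) (K := 2 * d ^ 3) hε
    (F := fun l t => if (l : ℂ) = 0 then 0 else -2 / (z - (l + t * φ l)) ^ 3)
    (F' := fun l t => -6 * φ l / (z - (l + t * φ l)) ^ 4)
    ?_ ?_).2.2
  · refine hasDerivAt_of_eventuallyEq_sub (g := fun t => -2 / z ^ 3 + ∑' l : L.lattice,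
      if (l : ℂ) = 0 then 0 else -2 / (z - (l + t * φ l)) ^ 3) ?_ ?_
    · convert! key.const_add (-2 / z ^ 3) using 1
      simp [deformDerivP]
    · filter_upwards [hM] with w hw
      rw [derivWeierstrassP_eq, derivWeierstrassPExcept,
        tsum_deformation hw (fun l => -2 / (z - l) ^ 3)]
  · intro l t ht
    split_ifs with hl
    · simpa [hl] using hasDerivAt_const t (0 : ℂ)
    · obtain ⟨h1, h2, -⟩ := h t ht l l.2 hl
      have := ((((hasDerivAt_line (l : ℂ) (φ l) t).const_sub z).fun_pow 3).fun_inv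
        (pow_ne_zero 3 h1)).const_mul (-2)
      convert! this using 1
      generalize z - ((l : ℂ) + t * φ l) = u at *
      simp only [Nat.cast_ofNat, Nat.reduceSub]
      field_simp
      ring
  · intro l t ht
    split_ifs with hl
    · rw [norm_zero]; positivity
    · obtain ⟨h1, h2, h3, h4, -⟩ := h t ht l l.2 hl
      exact norm_derivWeierstrassP_term_le hd.le h3 h4 hzd

theorem hasDerivAt_weierstrassZeta_deformation
    (hM : ∀ᶠ w in 𝓝 w₀, L.IsDeformation (M w) φ (w - w₀)) (hz : z ∉ L.lattice) :
    HasDerivAt (fun w => (M w).weierstrassZeta z) (L.deformZeta φ z) w₀ := by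
  obtain ⟨ε, hε, d, hd, h⟩ := L.exists_deformed_lattice_bounds φ (z₀ := z) (fun hz' => hz hz'.1)
  obtain ⟨hzd, h⟩ := h z (mem_ball_self hε)
  have key := (L.hasDerivAt_tsum_lattice (x := 0) (K := d ^ 5) hε
    (F := fun l t => if (l : ℂ) = 0 then 0 else
      (1 / (z - (l + t * φ l)) + 1 / ((l : ℂ) + t * φ l) + z / ((l : ℂ) + t * φ l) ^ 2))
    (F' := fun l t => φ l * (1 / (z - (l + t * φ l)) ^ 2 - 1 / ((l : ℂ) + t * φ l) ^ 2
      - 2 * z / ((l : ℂ) + t * φ l) ^ 3))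
    ?_ ?_).2.2
  · refine hasDerivAt_of_eventuallyEq_sub (g := fun t => 1 / z + ∑' l : L.lattice,
      if (l : ℂ) = 0 then 0 else
      (1 / (z - (l + t * φ l)) + 1 / ((l : ℂ) + t * φ l) + z / ((l : ℂ) + t * φ l) ^ 2)) ?_ ?_
    · convert! key.const_add (1 / z) using 1
      simp [deformZeta]
    · filter_upwards [hM] with w hw
      rw [weierstrassZeta_eq, weierstrassZetaExcept,
        tsum_deformation hw (fun l => 1 / (z - l) + 1 / l + z / l ^ 2)]
  · intro l t ht
    split_ifs with hl
    · simpa [hl] using hasDerivAt_const t (0 : ℂ)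
    · obtain ⟨h1, h2, -⟩ := h t ht l l.2 hl
      have := ((((hasDerivAt_line (l : ℂ) (φ l) t).const_sub z).fun_inv h1).fun_add
        ((hasDerivAt_line (l : ℂ) (φ l) t).fun_inv h2)).fun_add
        ((((hasDerivAt_line (l : ℂ) (φ l) t).fun_pow 2).fun_inv (pow_ne_zero 2 h2)).const_mul z)
      convert! this using 1
      · ext; simp [div_eq_mul_inv]
      · generalize (l : ℂ) + t * φ l = q at *
        generalize z - q = u at *
        simp only [Nat.cast_ofNat, Nat.reduceSub, pow_one]
        field_simp
        ring
  · intro l t ht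
    split_ifs with hl
    · rw [norm_zero]; positivity
    · obtain ⟨h1, h2, h3, h4, -⟩ := h t ht l l.2 hl
      exact norm_weierstrassZeta_term_le hd.le h1 h2 h3 h4 hzd

/-- The elementary factor of the product for `σ` differs from `1` to third order. -/
theorem norm_elementaryFactor_sub_one_le (w : ℂ) :
    ‖(1 - w) * Complex.exp (w + w ^ 2 / 2) - 1‖ ≤
      ‖w‖ ^ 3 * Real.exp (‖w‖ + ‖w‖ ^ 2 / 2) := by
  -- The derivative is −u² times the exponential, since −1 + (1 − u)(1 + u) = −u². The mean value
  -- inequality on the disc of radius |w| then yields the third power.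
  have hder : ∀ u : ℂ, HasDerivAt (fun u : ℂ => (1 - u) * Complex.exp (u + u ^ 2 / 2))
      (-u ^ 2 * Complex.exp (u + u ^ 2 / 2)) u := by
    intro u
    have h1 := ((hasDerivAt_id u).fun_add (((hasDerivAt_id u).fun_pow 2).div_const 2)).cexp
    convert! ((hasDerivAt_id u).const_sub 1).fun_mul h1 using 1
    simp only [id]
    push_cast
    ring
  have := Convex.norm_image_sub_le_of_norm_hasDerivWithin_le
    (s := closedBall (0 : ℂ) ‖w‖) (x := 0) (y := w)
    (C := ‖w‖ ^ 2 * Real.exp (‖w‖ + ‖w‖ ^ 2 / 2))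
    (fun u _ => (hder u).hasDerivWithinAt) ?_ (convex_closedBall 0 ‖w‖) (by simp) (by simp)
  · simp only [sub_zero, zero_pow two_ne_zero, zero_div, add_zero, Complex.exp_zero, mul_one]
      at this
    refine this.trans_eq ?_
    ring
  · intro u hu
    rw [mem_closedBall, dist_zero_right] at hu
    rw [norm_mul, norm_neg, norm_pow, Complex.norm_exp]
    gcongr
    refine (Complex.re_le_norm _).trans ((norm_add_le _ _).trans ?_)
    rw [norm_div, norm_pow, Complex.norm_ofNat]
    gcongr

/-- The product converges locally uniformly in `t`, and since z is not a period no factor vanishes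
at t = 0. The logarithmic derivative of the product is therefore the sum of those of its factors,
which is `deformSigma`. -/
theorem hasDerivAt_weierstrassSigma_deformation
    (hM : ∀ᶠ w in 𝓝 w₀, L.IsDeformation (M w) φ (w - w₀)) (hz : z ∉ L.lattice) :
    HasDerivAt (fun w => (M w).weierstrassSigma z)
      (L.deformSigma φ z * (M w₀).weierstrassSigma z) w₀ := by
  have hz' : z ∈ ((L.lattice : Set ℂ) \ {0})ᶜ := fun hz' => hz hz'.1
  obtain ⟨ε, hε, d, hd, h⟩ := L.exists_deformed_lattice_bounds φ hz'
  obtain ⟨hzd, h⟩ := h z (mem_ball_self hε)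
  set E : ℂ → ℂ := fun l => (1 - z / l) * Complex.exp (z / l + z ^ 2 / (2 * l ^ 2)) with hE
  set f : L.lattice → ℂ → ℂ := fun l t =>
    if (l : ℂ) = 0 then 0 else E (l + t * φ l) - 1 with hf
  have hf1 : ∀ t, ∀ l : L.lattice,
      1 + f l t = if (l : ℂ) = 0 then 1 else E (l + t * φ l) := by
    intro t l
    simp only [hf]
    split_ifs <;> ring
  have hEder : ∀ l : L.lattice, (l : ℂ) ≠ 0 → ∀ t ∈ ball (0 : ℂ) ε,
      HasDerivAt (fun t => E (l + t * φ l)) (φ l * (z ^ 3 / ((l + t * φ l) ^ 3 *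
        ((l + t * φ l) - z))) * E (l + t * φ l)) t := by
    intro l hl t ht
    obtain ⟨h1, h2, -⟩ := h t ht l l.2 hl
    have h1' : (l + t * φ l) - z ≠ 0 := by rwa [← neg_sub, neg_ne_zero]
    have hi := ((hasDerivAt_line (l : ℂ) (φ l) t).fun_inv h2).const_mul z
    have := (hi.const_sub 1).fun_mul (hi.fun_add ((hi.fun_pow 2).div_const 2)).cexp
    convert! this using 1
    · ext u
      simp only [hE]
      congr 2
      rw [div_eq_mul_inv, div_eq_mul_inv, mul_inv, mul_pow, inv_pow]
      ring
    · have e : z / (l + t * φ l) + z ^ 2 / (2 * (l + t * φ l) ^ 2) =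
          z * (l + t * φ l)⁻¹ + (z * (l + t * φ l)⁻¹) ^ 2 / 2 := by
        field_simp
      simp only [hE, e]
      generalize Complex.exp (z * (l + t * φ l)⁻¹ + (z * (l + t * φ l)⁻¹) ^ 2 / 2) = X
      generalize (l : ℂ) + t * φ l = q at *
      simp only [Nat.cast_ofNat, Nat.reduceSub, pow_one]
      field_simp
      ring
  have hfd : ∀ l, DifferentiableOn ℂ (f l) (ball 0 ε) := by
    intro l t ht
    simp only [hf]
    split_ifs with hl
    · exact differentiableWithinAt_const _
    · exact ((hEder l hl t ht).sub_const 1).differentiableAt.differentiableWithinAt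
  have hfb : ∀ l, ∀ t ∈ ball (0 : ℂ) ε,
      ‖f l t‖ ≤ d ^ 6 * Real.exp (d ^ 3 + (d ^ 3) ^ 2 / 2) * ‖(l : ℂ)‖⁻¹ ^ 3 := by
    intro l t ht
    simp only [hf]
    split_ifs with hl
    · rw [norm_zero]; positivity
    · obtain ⟨h1, h2, h3, h4, h5⟩ := h t ht l l.2 hl
      have e : E (l + t * φ l) = (1 - z / (l + t * φ l)) *
          Complex.exp (z / (l + t * φ l) + (z / (l + t * φ l)) ^ 2 / 2) := by
        simp only [hE]
        congr 2
        field_simp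
      have hw : ‖z / (l + t * φ l)‖ ≤ d * (d * ‖(l : ℂ)‖⁻¹) := by
        rw [div_eq_mul_inv, norm_mul]
        gcongr
      have hw' : ‖z / (l + t * φ l)‖ ≤ d ^ 3 := by
        refine hw.trans ?_
        calc d * (d * ‖(l : ℂ)‖⁻¹) ≤ d * (d * d) := by gcongr
          _ = d ^ 3 := by ring
      rw [e]
      refine (norm_elementaryFactor_sub_one_le _).trans ?_
      calc _ ≤ (d * (d * ‖(l : ℂ)‖⁻¹)) ^ 3 * Real.exp (d ^ 3 + (d ^ 3) ^ 2 / 2) := by gcongr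
        _ = _ := by ring
  have hs : Summable fun l : L.lattice =>
      d ^ 6 * Real.exp (d ^ 3 + (d ^ 3) ^ 2 / 2) * ‖(l : ℂ)‖⁻¹ ^ 3 :=
    L.summable_norm_inv_pow_three.mul_left _
  have h0 : (0 : ℂ) ∈ ball (0 : ℂ) ε := mem_ball_self hε
  have hprod := Summable.hasProdLocallyUniformlyOn_one_add isOpen_ball hs
    (Eventually.of_forall hfb) fun l => (hfd l).continuousOn
  have hfd' : ∀ l, DifferentiableOn ℂ (fun t => 1 + f l t) (ball 0 ε) := fun l =>
    (hfd l).const_add 1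
  have hdiff : DifferentiableAt ℂ (fun t => ∏' l, (1 + f l t)) 0 :=
    (hprod.differentiableOn (Eventually.of_forall fun s => .fun_finsetProd fun l _ => hfd' l)
      isOpen_ball).differentiableAt (isOpen_ball.mem_nhds h0)
  have hne : ∀ l, 1 + f l 0 ≠ 0 := by
    intro l
    rw [hf1]
    split_ifs with hl
    · exact one_ne_zero
    · refine mul_ne_zero ?_ (Complex.exp_ne_zero _)
      rw [zero_mul, add_zero, sub_ne_zero, ne_eq, eq_comm, div_eq_one_iff_eq hl]
      rintro rfl
      exact hz l.2
  have hne' : ∏' l, (1 + f l 0) ≠ 0 :=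
    tprod_one_add_ne_zero_of_summable hne (hs.of_nonneg_of_le (fun _ => norm_nonneg _)
      fun l => hfb l 0 h0)
  have hlog : ∀ l, logDeriv (fun t => 1 + f l t) 0 = φ l * (z ^ 3 / ((l : ℂ) ^ 3 * (l - z))) := by
    intro l
    simp only [hf1]
    split_ifs with hl
    · simp [hl, logDeriv]
    · have h1 := hEder l hl 0 h0
      have h2 : E l ≠ 0 := by
        have := hne l
        simpa [hf1, hl] using this
      simp only [zero_mul, add_zero] at h1
      rw [logDeriv_apply, h1.deriv, zero_mul, add_zero, mul_div_assoc, div_self h2, mul_one]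
  have key := logDeriv_tprod_eq_tsum isOpen_ball h0 hne hfd'
    (by simpa only [hlog] using (L.hasSum_deformSigma_and_hasDerivAt φ hz').1.summable)
    hprod.multipliableLocallyUniformlyOn hne'
  simp only [hlog] at key
  change _ = L.deformSigma φ z at key
  have hder := hdiff.hasDerivAt
  rw [logDeriv_apply, div_eq_iff hne'] at key
  rw [key] at hder
  have hsig : ∀ᶠ w in 𝓝 w₀, (M w).weierstrassSigma z = z * ∏' l, (1 + f l (w - w₀)) := by
    filter_upwards [hM] with w hw
    simp only [hf1]
    rw [← tprod_deformation hw E, weierstrassSigma]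
  convert! hasDerivAt_of_eventuallyEq_sub (hder.const_mul z) hsig using 1
  rw [hsig.self_of_nhds, sub_self]
  ring

end

/-! ### Quasi-periodicity, Liouville's theorem and uniqueness off the lattice -/

variable (L : PeriodPair)

theorem isPreconnected_compl_lattice : IsPreconnected ((L.lattice : Set ℂ)ᶜ) :=
  (Set.Countable.isConnected_compl_of_one_lt_rank (by simp)
    (countable_of_Lindelof_of_discrete (X := L.lattice))).2

theorem isOpen_compl_lattice : IsOpen ((L.lattice : Set ℂ)ᶜ) :=
  L.isClosed_lattice.isOpen_compl

theorem eventually_notMem_lattice_nhdsNE_zero : ∀ᶠ z in 𝓝[≠] (0 : ℂ), z ∉ L.lattice := by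
  filter_upwards [self_mem_nhdsWithin, mem_nhdsWithin_of_mem_nhds
    (L.compl_lattice_sdiff_singleton_mem_nhds 0)] with z hz hz' hzL
  exact hz' ⟨hzL, hz⟩

theorem weierstrassZeta_neg (z : ℂ) : L.weierstrassZeta (-z) = -L.weierstrassZeta z := by
  simp only [weierstrassZeta]
  rw [← (Equiv.neg L.lattice).tsum_eq, neg_add, ← tsum_neg]
  congr 1
  · rw [div_neg]
  · congr 1 with l
    simp only [Equiv.neg_apply, NegMemClass.coe_neg, neg_eq_zero]
    split_ifs
    · simp
    · rw [show -z - -(l : ℂ) = -(z - l) by ring, div_neg, div_neg]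
      ring

variable {L}

theorem hasDerivAt_weierstrassZeta {z : ℂ} (hz : z ∉ L.lattice) :
    HasDerivAt L.weierstrassZeta (-L.weierstrassP z) z := by
  have hz0 : z ≠ 0 := fun h => hz (h ▸ zero_mem _)
  have := (hasDerivAt_inv hz0).add
    (L.hasDerivAt_weierstrassZetaExcept (z := z) fun h => hz h.1)
  convert! this using 1
  · ext w
    rw [weierstrassZeta_eq, one_div]
    rfl
  · rw [weierstrassP_eq]
    ring

theorem hasDerivAt_weierstrassP {z : ℂ} (hz : z ∉ L.lattice) :
    HasDerivAt L.weierstrassP (L.derivWeierstrassP z) z := by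
  rw [← L.deriv_weierstrassP]
  exact (L.differentiableOn_weierstrassP.differentiableAt
    (L.isOpen_compl_lattice.mem_nhds hz)).hasDerivAt

theorem add_mem_lattice_iff {z ω : ℂ} (hω : ω ∈ L.lattice) :
    z + ω ∈ L.lattice ↔ z ∈ L.lattice :=
  Submodule.add_mem_iff_left _ hω

/-- Quasi-periodicity of the Weierstrass zeta function. -/
theorem weierstrassZeta_add {z ω : ℂ} (hω : ω ∈ L.lattice) (hω2 : ω / 2 ∉ L.lattice)
    (hz : z ∉ L.lattice) :
    L.weierstrassZeta (z + ω) = L.weierstrassZeta z + 2 * L.weierstrassZeta (ω / 2) := by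
  have hd₁ : ∀ w ∈ ((L.lattice : Set ℂ)ᶜ),
      HasDerivAt (fun w => L.weierstrassZeta (w + ω)) (-L.weierstrassP w) w := by
    intro w hw
    have := (hasDerivAt_weierstrassZeta (L := L) (z := w + ω)
      (by rwa [add_mem_lattice_iff hω])).comp_add_const w ω
    rwa [L.weierstrassP_add_coe w ⟨ω, hω⟩] at this
  have hd₂ : ∀ w ∈ ((L.lattice : Set ℂ)ᶜ),
      HasDerivAt (fun w => L.weierstrassZeta w + 2 * L.weierstrassZeta (ω / 2))
        (-L.weierstrassP w) w := fun w hw => (hasDerivAt_weierstrassZeta hw).add_const _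
  -- Both sides have derivative −℘ on a connected open set; the constant is compared at −ω/2, where
  -- ζ is odd.
  refine L.isOpen_compl_lattice.eqOn_of_deriv_eq L.isPreconnected_compl_lattice
    (fun w hw => (hd₁ w hw).differentiableAt.differentiableWithinAt)
    (fun w hw => (hd₂ w hw).differentiableAt.differentiableWithinAt)
    (fun w hw => (hd₁ w hw).deriv.trans (hd₂ w hw).deriv.symm) (x := -(ω / 2)) ?_ ?_ hz
  · simpa using hω2
  · rw [weierstrassZeta_neg, show -(ω / 2) + ω = ω / 2 by ring]
    ring

theorem deformP_neg (φ : ℂ →L[ℝ] ℂ) (z : ℂ) : L.deformP φ (-z) = L.deformP φ z := by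
  simp only [deformP]
  rw [← (Equiv.neg L.lattice).tsum_eq]
  congr 1 with l
  simp only [Equiv.neg_apply, NegMemClass.coe_neg, map_neg]
  rw [show -z - -(l : ℂ) = -(z - l) by ring, Odd.neg_pow (by decide), Odd.neg_pow (by decide),
    div_neg, div_neg]
  ring

/-- The failure of `deformP` to be periodic. -/
theorem deformP_add (φ : ℂ →L[ℝ] ℂ) {z ω : ℂ} (hω : ω ∈ L.lattice) (hω2 : ω / 2 ∉ L.lattice)
    (hz : z ∉ L.lattice) :
    L.deformP φ (z + ω) = L.deformP φ z - φ ω * L.derivWeierstrassP z := by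
  -- After the shift l ↦ l + ω in the first series, all terms in (w − l)⁻³ cancel and what remains
  -- is free of w. The sum is thus constant in w, and at w = −ω/2 it vanishes because `deformP` is
  -- even and ℘'(−ω/2) = 0.
  have hs : ∀ w ∉ L.lattice, HasSum (fun l : L.lattice =>
      2 * φ (l + ω) / (l + ω) ^ 3 - 2 * φ l / (l : ℂ) ^ 3)
      (L.deformP φ (w + ω) - L.deformP φ w + φ ω * L.derivWeierstrassP w) := by
    intro w hw
    have hw' : w + ω ∉ L.lattice := by rwa [add_mem_lattice_iff hω]
    have h1 := (L.hasSum_deformP_and_hasDerivAt φ (z := w + ω) fun h => hw' h.1).1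
    rw [← (Equiv.addRight (⟨ω, hω⟩ : L.lattice)).hasSum_iff] at h1
    have h2 := (L.hasSum_deformP_and_hasDerivAt φ (z := w) fun h => hw h.1).1
    have h3 := (L.hasSum_derivWeierstrassP w).mul_left (φ ω)
    convert! (h1.sub h2).add h3 using 1
    ext l
    simp only [Function.comp_apply, Equiv.coe_addRight, Submodule.coe_add, map_add,
      add_sub_add_right_eq_sub]
    ring
  have hneg : -(ω / 2) ∉ L.lattice := by simpa using hω2
  have h0 : L.derivWeierstrassP (-(ω / 2)) = 0 := by
    have h1 := L.derivWeierstrassP_add_coe (-(ω / 2)) ⟨ω, hω⟩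
    simp only [show -(ω / 2) + ω = ω / 2 by ring] at h1
    have h2 := L.derivWeierstrassP_neg (ω / 2)
    linear_combination (h2 - h1) / 2
  have := (hs z hz).unique (hs _ hneg)
  rw [h0, show -(ω / 2) + ω = ω / 2 by ring, deformP_neg] at this
  linear_combination this

/-- A holomorphic function on the complement of the lattice which has the basic periods and
tends to zero at the origin vanishes. -/
theorem eq_zero_of_periodic_of_tendsto_zero {f : ℂ → ℂ}
    (hd : DifferentiableOn ℂ f (L.lattice : Set ℂ)ᶜ)
    (h₁ : ∀ z ∉ L.lattice, f (z + L.ω₁) = f z) (h₂ : ∀ z ∉ L.lattice, f (z + L.ω₂) = f z)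
    (h₀ : Tendsto f (𝓝[≠] 0) (𝓝 0)) {z : ℂ} (hz : z ∉ L.lattice) : f z = 0 := by
  classical
  -- The extension by 0 is continuous at the origin, so the singularity there is removable;
  -- periodicity carries this to every period. The result is entire and periodic, hence bounded and
  -- constant.
  set g : ℂ → ℂ := fun z => if z ∈ L.lattice then 0 else f z with hg
  have hgf : ∀ z ∉ L.lattice, g z = f z := fun z hz => if_neg hz
  have hg0 : ∀ z ∈ L.lattice, g z = 0 := fun z hz => if_pos hz
  let S : AddSubgroup ℂ :=
    { carrier := { w | ∀ z, g (z + w) = g z }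
      add_mem' := by
        intro a b ha hb z
        rw [← add_assoc, hb, ha]
      zero_mem' := by simp
      neg_mem' := by
        intro a ha z
        rw [← ha (z + -a), neg_add_cancel_right] }
  have hgen : ∀ ω ∈ L.lattice, (∀ z ∉ L.lattice, f (z + ω) = f z) → ω ∈ S := by
    intro ω hω h z
    by_cases hz : z ∈ L.lattice
    · rw [hg0 z hz, hg0 _ (add_mem hz hω)]
    · rw [hgf z hz, hgf _ (by rwa [add_mem_lattice_iff hω]), h z hz]
  have hper : ∀ z, ∀ w ∈ L.lattice, g (z + w) = g z := by
    have : L.lattice ≤ S.toIntSubmodule := by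
      rw [lattice, Submodule.span_le]
      rintro _ (rfl | rfl)
      · exact hgen _ L.ω₁_mem_lattice h₁
      · exact hgen _ L.ω₂_mem_lattice h₂
    exact fun z w hw => this hw z
  have hdiff : ∀ z ∉ L.lattice, DifferentiableAt ℂ g z := by
    intro z hz
    refine (hd.differentiableAt (L.isOpen_compl_lattice.mem_nhds hz)).congr_of_eventuallyEq ?_
    filter_upwards [L.isOpen_compl_lattice.mem_nhds hz] with w hw using hgf w hw
  have hdiff0 : DifferentiableAt ℂ g 0 := by
    refine (Complex.analyticAt_of_differentiable_on_punctured_nhds_of_continuousAt ?_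
      ?_).differentiableAt
    · filter_upwards [L.eventually_notMem_lattice_nhdsNE_zero] with w hw using hdiff w hw
    · rw [continuousAt_iff_punctured_nhds, hg0 0 (zero_mem _)]
      refine h₀.congr' ?_
      filter_upwards [L.eventually_notMem_lattice_nhdsNE_zero] with w hw using (hgf w hw).symm
  have hdiff' : Differentiable ℂ g := by
    intro z
    by_cases hz : z ∈ L.lattice
    · have : g = fun w => g (w - z) := by
        ext w
        rw [sub_eq_add_neg, hper w (-z) (neg_mem hz)]
      rw [this]
      refine DifferentiableAt.comp z (g := g) (f := fun w => w - z) ?_ (by fun_prop)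
      rwa [sub_self]
    · exact hdiff z hz
  rw [← hgf z hz, hdiff'.apply_eq_apply_of_bounded
    (IsZLattice.isCompact_range_of_periodic L.lattice g hdiff'.continuous hper).isBounded z 0,
    hg0 0 (zero_mem _)]

/-- A function with zero derivative on the complement of the lattice which tends to zero at the
origin vanishes. -/
theorem eq_zero_of_hasDerivAt_zero {f : ℂ → ℂ}
    (hd : ∀ z ∉ L.lattice, HasDerivAt f 0 z) (h₀ : Tendsto f (𝓝[≠] 0) (𝓝 0)) {z : ℂ}
    (hz : z ∉ L.lattice) : f z = 0 := by
  have hconst : ∀ w ∉ L.lattice, f w = f z := fun w hw =>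
    L.isOpen_compl_lattice.is_const_of_deriv_eq_zero L.isPreconnected_compl_lattice
      (fun u hu => (hd u hu).differentiableAt.differentiableWithinAt)
      (fun u hu => (hd u hu).deriv) hw hz
  refine tendsto_nhds_unique (tendsto_const_nhds.congr' ?_) h₀
  filter_upwards [L.eventually_notMem_lattice_nhdsNE_zero] with w hw using (hconst w hw).symm

/-! ### Leading terms at the origin and the equation for ℘'' -/

/-- Integration of a leading-order asymptotic at the origin. -/
theorem tendsto_div_pow_succ_of_hasDerivAt {f f' : ℂ → ℂ} {c : ℂ} {n : ℕ} (hn : n ≠ 0)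
    (hf : ∀ᶠ z in 𝓝 0, HasDerivAt f (f' z) z) (hf0 : f 0 = 0) (hf'0 : f' 0 = 0)
    (h : Tendsto (fun z => f' z / z ^ n) (𝓝[≠] 0) (𝓝 c)) :
    Tendsto (fun z => f z / z ^ (n + 1)) (𝓝[≠] 0) (𝓝 (c / (n + 1))) := by
  rw [Metric.tendsto_nhds]
  intro ε hε
  -- The estimate must hold at 0 as well, since the mean value inequality is applied on a disc
  -- containing it; there `f' 0 = 0` and `n ≠ 0` are used.
  have h1 : ∀ᶠ z in 𝓝 (0 : ℂ), HasDerivAt f (f' z) z ∧ ‖f' z - c * z ^ n‖ ≤ ε / 2 * ‖z‖ ^ n := by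
    refine hf.and ?_
    have := eventually_nhdsWithin_iff.mp ((Metric.tendsto_nhds.mp h) (ε / 2) (by positivity))
    filter_upwards [this] with z hz
    rcases eq_or_ne z 0 with rfl | hz0
    · simp [hf'0, hn]
    · have := (hz hz0).le
      rw [dist_eq_norm, div_sub' (pow_ne_zero n hz0), norm_div, norm_pow,
        div_le_iff₀ (by positivity)] at this
      rwa [mul_comm c]
  obtain ⟨δ, hδ, h2⟩ := Metric.eventually_nhds_iff_ball.mp h1
  filter_upwards [self_mem_nhdsWithin, mem_nhdsWithin_of_mem_nhds (ball_mem_nhds 0 hδ)]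
    with z hz0 hzδ
  have hz0 : z ≠ 0 := hz0
  rw [mem_ball, dist_zero_right] at hzδ
  have hsub : closedBall (0 : ℂ) ‖z‖ ⊆ ball 0 δ := closedBall_subset_ball hzδ
  have hn1 : ((n : ℂ) + 1) ≠ 0 := by exact_mod_cast n.succ_ne_zero
  have key := Convex.norm_image_sub_le_of_norm_hasDerivWithin_le
    (f := fun u => f u - c / (n + 1) * u ^ (n + 1)) (f' := fun u => f' u - c * u ^ n)
    (s := closedBall (0 : ℂ) ‖z‖) (x := 0) (y := z) (C := ε / 2 * ‖z‖ ^ n) ?_ ?_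
    (convex_closedBall 0 ‖z‖) (by simp) (by simp)
  · simp only [hf0, zero_pow n.succ_ne_zero, mul_zero, sub_zero] at key
    have hpos : 0 < ‖z‖ ^ (n + 1) := pow_pos (norm_pos_iff.mpr hz0) _
    rw [dist_eq_norm, div_sub' (pow_ne_zero _ hz0), norm_div, norm_pow, div_lt_iff₀ hpos,
      mul_comm _ (c / _)]
    rw [mul_assoc, ← pow_succ] at key
    nlinarith
  · intro u hu
    have := ((h2 u (hsub hu)).1.sub
      ((hasDerivAt_pow (n + 1) u).const_mul (c / (n + 1)))).hasDerivWithinAt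
      (s := closedBall (0 : ℂ) ‖z‖)
    convert! this using 1
    push_cast
    field_simp
  · intro u hu
    refine (h2 u (hsub hu)).2.trans ?_
    rw [mem_closedBall, dist_zero_right] at hu
    gcongr

variable (L)

theorem eventually_hasDerivAt_except :
    ∀ᶠ z in 𝓝 (0 : ℂ), HasDerivAt (L.weierstrassPExcept 0) (L.derivWeierstrassPExcept 0 z) z ∧
      HasDerivAt L.weierstrassZetaExcept (-L.weierstrassPExcept 0 z) z := by
  filter_upwards [L.compl_lattice_sdiff_singleton_mem_nhds 0] with z hz
  refine ⟨?_, L.hasDerivAt_weierstrassZetaExcept hz⟩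
  rw [← L.eqOn_deriv_weierstrassPExcept_derivWeierstrassPExcept 0 hz]
  exact ((L.differentiableOn_weierstrassPExcept 0).differentiableAt
    (L.isOpen_compl_lattice_sdiff.mem_nhds hz)).hasDerivAt

theorem weierstrassZetaExcept_zero : L.weierstrassZetaExcept 0 = 0 := by
  simp [weierstrassZetaExcept]

/-- The coefficient 6G₄ here integrates to 3G₄ for ℘ and −G₄ for ζ. With the polar parts, these
leading terms give all the constants in g₂ = 60G₄ needed below. -/
theorem tendsto_derivWeierstrassPExcept_div :
    Tendsto (fun z => L.derivWeierstrassPExcept 0 z / z) (𝓝[≠] 0) (𝓝 (6 * L.G 4)) := by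
  have h := (L.analyticAt_derivWeierstrassPExcept 0).differentiableAt.hasDerivAt
  rw [L.deriv_derivWeierstrassPExcept_self, hasDerivAt_iff_tendsto_slope_zero] at h
  simpa [div_eq_inv_mul] using h

theorem tendsto_weierstrassPExcept_div :
    Tendsto (fun z => L.weierstrassPExcept 0 z / z ^ 2) (𝓝[≠] 0) (𝓝 (3 * L.G 4)) := by
  have := tendsto_div_pow_succ_of_hasDerivAt (f := L.weierstrassPExcept 0) (n := 1) one_ne_zero
    (L.eventually_hasDerivAt_except.mono fun z hz => hz.1) (by simp) (by simp)
    (by simpa using L.tendsto_derivWeierstrassPExcept_div)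
  convert this using 2
  push_cast
  ring

theorem tendsto_weierstrassZetaExcept_div :
    Tendsto (fun z => L.weierstrassZetaExcept z / z ^ 3) (𝓝[≠] 0) (𝓝 (-L.G 4)) := by
  have := tendsto_div_pow_succ_of_hasDerivAt (f := L.weierstrassZetaExcept)
    (f' := fun z => -L.weierstrassPExcept 0 z) (n := 2) two_ne_zero
    (L.eventually_hasDerivAt_except.mono fun z hz => hz.2) L.weierstrassZetaExcept_zero (by simp)
    (c := -(3 * L.G 4)) (by simpa only [neg_div] using L.tendsto_weierstrassPExcept_div.neg)
  convert this using 2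
  push_cast
  ring

theorem tendsto_weierstrassPExcept : Tendsto (L.weierstrassPExcept 0) (𝓝[≠] 0) (𝓝 0) := by
  have h := (L.analyticAt_weierstrassPExcept 0).continuousAt.tendsto
  rw [L.weierstrassPExcept_zero] at h
  exact h.mono_left nhdsWithin_le_nhds

theorem tendsto_derivWeierstrassPExcept :
    Tendsto (L.derivWeierstrassPExcept 0) (𝓝[≠] 0) (𝓝 0) := by
  have h := (L.analyticAt_derivWeierstrassPExcept 0).continuousAt.tendsto
  rw [L.derivWeierstrassPExcept_zero_zero] at h
  exact h.mono_left nhdsWithin_le_nhds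

theorem tendsto_weierstrassZetaExcept : Tendsto L.weierstrassZetaExcept (𝓝[≠] 0) (𝓝 0) := by
  have h := (L.hasDerivAt_weierstrassZetaExcept (z := 0) (by simp)).continuousAt.tendsto
  rw [L.weierstrassZetaExcept_zero] at h
  exact h.mono_left nhdsWithin_le_nhds

theorem tendsto_id_nhdsNE_zero : Tendsto (fun z : ℂ => z) (𝓝[≠] 0) (𝓝 0) :=
  tendsto_id.mono_left nhdsWithin_le_nhds

variable {L}

/-- `℘'' = 6 ℘² - g₂ / 2`. -/
theorem hasDerivAt_derivWeierstrassP {z : ℂ} (hz : z ∉ L.lattice) :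
    HasDerivAt L.derivWeierstrassP (6 * L.weierstrassP z ^ 2 - L.g₂ / 2) z := by
  have hd : ∀ w ∉ L.lattice, HasDerivAt L.derivWeierstrassP (deriv L.derivWeierstrassP w) w :=
    fun w hw => (L.analyticOnNhd_derivWeierstrassP w hw).differentiableAt.hasDerivAt
  have key : deriv L.derivWeierstrassP z - (6 * L.weierstrassP z ^ 2 - L.g₂ / 2) = 0 := by
    refine eq_zero_of_periodic_of_tendsto_zero (L := L)
      (f := fun z => deriv L.derivWeierstrassP z - (6 * L.weierstrassP z ^ 2 - L.g₂ / 2))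
      ?_ ?_ ?_ ?_ hz
    · intro w hw
      have h1 := (L.analyticOnNhd_derivWeierstrassP w hw).deriv.differentiableAt
      have h2 := (L.analyticOnNhd_weierstrassP w hw).differentiableAt
      exact (h1.sub (((h2.pow 2).const_mul 6).sub_const _)).differentiableWithinAt
    · intro w _
      have h1 := L.weierstrassP_add_coe w ⟨_, L.ω₁_mem_lattice⟩
      have h2 : L.derivWeierstrassP = fun w => L.derivWeierstrassP (w + L.ω₁) :=
        funext fun w => (L.derivWeierstrassP_add_coe w ⟨_, L.ω₁_mem_lattice⟩).symm
      simp only at h1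
      nth_rw 2 [h2]
      rw [h1, deriv_comp_add_const]
    · intro w _
      have h1 := L.weierstrassP_add_coe w ⟨_, L.ω₂_mem_lattice⟩
      have h2 : L.derivWeierstrassP = fun w => L.derivWeierstrassP (w + L.ω₂) :=
        funext fun w => (L.derivWeierstrassP_add_coe w ⟨_, L.ω₂_mem_lattice⟩).symm
      simp only at h1
      nth_rw 2 [h2]
      rw [h1, deriv_comp_add_const]
    · have hder : Tendsto (deriv (L.derivWeierstrassPExcept 0)) (𝓝[≠] 0) (𝓝 (6 * L.G 4)) := by
        have h := (L.analyticAt_derivWeierstrassPExcept 0).deriv.continuousAt.tendsto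
        rw [L.deriv_derivWeierstrassPExcept_self, L.sumInvPow_zero] at h
        exact h.mono_left nhdsWithin_le_nhds
      -- The poles 6/z⁴ of ℘'' and 6℘² cancel. The constant terms are 6G₄ from ℘'', −36G₄ from the
      -- cross term of −6℘², and 30G₄ = g₂/2.
      have := ((hder.sub (L.tendsto_weierstrassPExcept_div.const_mul 12)).sub
        ((L.tendsto_weierstrassPExcept.pow 2).const_mul 6)).add_const (30 * L.G 4)
      rw [show 6 * L.G 4 - 12 * (3 * L.G 4) - 6 * 0 ^ 2 + 30 * L.G 4 = 0 by ring] at this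
      refine this.congr' ?_
      filter_upwards [self_mem_nhdsWithin, L.eventually_notMem_lattice_nhdsNE_zero] with w hw hwL
      have hw0 : w ≠ 0 := hw
      have h1 := (((hasDerivAt_id w).fun_pow 3).fun_inv (pow_ne_zero 3 hw0)).const_mul (-2)
      have h2 := (L.analyticOnNhd_derivWeierstrassPExcept 0 w
        fun h => hwL h.1).differentiableAt.hasDerivAt
      have h3 : deriv L.derivWeierstrassP w = 6 / w ^ 4 + deriv (L.derivWeierstrassPExcept 0) w := by
        rw [show L.derivWeierstrassP = fun z => -2 * (z ^ 3)⁻¹ + L.derivWeierstrassPExcept 0 z from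
          funext fun z => by rw [derivWeierstrassP_eq, div_eq_mul_inv]]
        refine (h1.add h2).deriv.trans ?_
        simp only [id, Nat.cast_ofNat, Nat.reduceSub]
        field_simp
        ring
      rw [h3, weierstrassP_eq, g₂]
      field_simp
      ring
  rw [← sub_eq_zero.mp key]
  exact hd z hz

/-! ### The deformation in the direction of the quasi-periods -/

variable (L)

/-- A real-linear map with prescribed values on the periods. -/
theorem exists_apply_periods (a b : ℂ) : ∃ φ : ℂ →L[ℝ] ℂ, φ L.ω₁ = a ∧ φ L.ω₂ = b := by
  refine ⟨(L.basis.constr ℝ ![a, b]).toContinuousLinearMap, ?_, ?_⟩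
  · have := L.basis.constr_basis ℝ ![a, b] 0
    simpa using this
  · have := L.basis.constr_basis ℝ ![a, b] 1
    simpa using this

variable {L} {φ : ℂ →L[ℝ] ℂ}

theorem tendsto_deformP (φ : ℂ →L[ℝ] ℂ) : Tendsto (L.deformP φ) (𝓝[≠] 0) (𝓝 0) := by
  have h := (L.hasSum_deformP_and_hasDerivAt φ (z := 0) (by simp)).2.2.continuousAt.tendsto
  have h0 : L.deformP φ 0 = 0 := by
    have : ∀ l : ℂ, 1 / (0 - l) ^ 3 + 1 / l ^ 3 = 0 := by
      intro l
      rw [zero_sub, Odd.neg_pow (by decide), div_neg, neg_add_cancel]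
    simp [deformP, this, -zero_sub, -one_div]
  rw [h0] at h
  exact h.mono_left nhdsWithin_le_nhds

theorem tendsto_deformZeta (φ : ℂ →L[ℝ] ℂ) : Tendsto (L.deformZeta φ) (𝓝[≠] 0) (𝓝 0) := by
  have h := (L.hasSum_deformZeta_and_hasDerivAt φ (z := 0) (by simp)).2.continuousAt.tendsto
  have h0 : L.deformZeta φ 0 = 0 := by
    simp [deformZeta]
  rw [h0] at h
  exact h.mono_left nhdsWithin_le_nhds

theorem tendsto_deformSigma (φ : ℂ →L[ℝ] ℂ) : Tendsto (L.deformSigma φ) (𝓝[≠] 0) (𝓝 0) := by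
  have h := (L.hasSum_deformSigma_and_hasDerivAt φ (z := 0) (by simp)).2.continuousAt.tendsto
  have h0 : L.deformSigma φ 0 = 0 := by
    simp [deformSigma]
  rw [h0] at h
  exact h.mono_left nhdsWithin_le_nhds

/-- `φ` sends the basic periods to the quasi-periods of the zeta function. -/
def IsQuasiPeriodMap (L : PeriodPair) (φ : ℂ →L[ℝ] ℂ) : Prop :=
  φ L.ω₁ = 2 * L.weierstrassZeta (L.ω₁ / 2) ∧ φ L.ω₂ = 2 * L.weierstrassZeta (L.ω₂ / 2)

/-- The defect −φ(ω)℘' of `deformP` and the defect 2ζ(ω/2)℘' of ζ℘' cancel for the basic periods.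
Adding 2℘² removes the pole −2/z⁴ of ζ℘', and the remaining constant 8G₄ + 12G₄ equals g₂/3, so
Liouville's theorem applies. -/
theorem IsQuasiPeriodMap.deformP_eq (h : L.IsQuasiPeriodMap φ) {z : ℂ} (hz : z ∉ L.lattice) :
    L.deformP φ z = -(L.weierstrassZeta z * L.derivWeierstrassP z + 2 * L.weierstrassP z ^ 2
      - L.g₂ / 3) := by
  have hper : ∀ ω ∈ L.lattice, ω / 2 ∉ L.lattice → φ ω = 2 * L.weierstrassZeta (ω / 2) →
      ∀ w ∉ L.lattice, L.deformP φ (w + ω) + (L.weierstrassZeta (w + ω) *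
        L.derivWeierstrassP (w + ω) + 2 * L.weierstrassP (w + ω) ^ 2 - L.g₂ / 3) =
      L.deformP φ w + (L.weierstrassZeta w * L.derivWeierstrassP w + 2 * L.weierstrassP w ^ 2
        - L.g₂ / 3) := by
    intro ω hω hω2 hφ w hw
    have h1 := L.weierstrassP_add_coe w ⟨ω, hω⟩
    have h2 := L.derivWeierstrassP_add_coe w ⟨ω, hω⟩
    simp only at h1 h2
    rw [h1, h2, weierstrassZeta_add hω hω2 hw, deformP_add φ hω hω2 hw, hφ]
    ring
  rw [eq_neg_iff_add_eq_zero]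
  refine eq_zero_of_periodic_of_tendsto_zero (L := L) (f := fun z => L.deformP φ z +
    (L.weierstrassZeta z * L.derivWeierstrassP z + 2 * L.weierstrassP z ^ 2 - L.g₂ / 3)) ?_
    (hper _ L.ω₁_mem_lattice L.ω₁_div_two_notMem_lattice h.1)
    (hper _ L.ω₂_mem_lattice L.ω₂_div_two_notMem_lattice h.2) ?_ hz
  · intro w hw
    have h1 := (L.hasSum_deformP_and_hasDerivAt φ (z := w) fun h => hw h.1).2.2.differentiableAt
    have h2 := (hasDerivAt_weierstrassZeta hw).differentiableAt
    have h3 := (hasDerivAt_weierstrassP hw).differentiableAt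
    have h4 := (hasDerivAt_derivWeierstrassP hw).differentiableAt
    exact (h1.add (((h2.mul h4).add ((h3.pow 2).const_mul 2)).sub_const _)).differentiableWithinAt
  · have := ((((((L.tendsto_deformP φ).sub (L.tendsto_weierstrassZetaExcept_div.const_mul 2)).add
      L.tendsto_derivWeierstrassPExcept_div).add
      (L.tendsto_weierstrassZetaExcept.mul L.tendsto_derivWeierstrassPExcept)).add
      (L.tendsto_weierstrassPExcept_div.const_mul 4)).add
      ((L.tendsto_weierstrassPExcept.pow 2).const_mul 2)).sub_const (20 * L.G 4)
    rw [show 0 - 2 * -L.G 4 + 6 * L.G 4 + 0 * 0 + 4 * (3 * L.G 4) + 2 * 0 ^ 2 - 20 * L.G 4 = 0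
      by ring] at this
    refine this.congr' ?_
    filter_upwards [self_mem_nhdsWithin] with w hw
    have hw0 : w ≠ 0 := hw
    rw [weierstrassZeta_eq, weierstrassP_eq, derivWeierstrassP_eq, g₂]
    field_simp
    ring

theorem IsQuasiPeriodMap.deformDerivP_eq (h : L.IsQuasiPeriodMap φ) {z : ℂ}
    (hz : z ∉ L.lattice) :
    L.deformDerivP φ z = -(3 * L.weierstrassP z * L.derivWeierstrassP z +
      L.weierstrassZeta z * (6 * L.weierstrassP z ^ 2 - L.g₂ / 2)) := by
  have h1 := (L.hasSum_deformP_and_hasDerivAt φ (z := z) fun h => hz h.1).2.2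
  have h2 := ((((hasDerivAt_weierstrassZeta hz).mul (hasDerivAt_derivWeierstrassP hz)).add
    (((hasDerivAt_weierstrassP hz).pow 2).const_mul 2)).sub_const (L.g₂ / 3)).neg
  rw [h1.unique (h2.congr_of_eventuallyEq ?_)]
  · push_cast
    ring
  · filter_upwards [L.isOpen_compl_lattice.mem_nhds hz] with w hw using h.deformP_eq hw

/-- An integral of the formula for `deformP`. The poles of ζ℘ and ℘'/2 cancel, so both sides tend to
0 at the origin and no constant appears. The formula for `deformSigma` follows from this one in the
same way. -/
theorem IsQuasiPeriodMap.deformZeta_eq (h : L.IsQuasiPeriodMap φ) {z : ℂ} (hz : z ∉ L.lattice) :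
    L.deformZeta φ z = L.weierstrassZeta z * L.weierstrassP z + L.derivWeierstrassP z / 2
      - L.g₂ / 12 * z := by
  rw [← sub_eq_zero]
  refine eq_zero_of_hasDerivAt_zero (L := L) (f := fun z => L.deformZeta φ z -
    (L.weierstrassZeta z * L.weierstrassP z + L.derivWeierstrassP z / 2 - L.g₂ / 12 * z))
    ?_ ?_ hz
  · intro w hw
    have h1 := (L.hasSum_deformZeta_and_hasDerivAt φ (z := w) fun h => hw h.1).2
    have h2 := (((hasDerivAt_weierstrassZeta hw).mul (hasDerivAt_weierstrassP hw)).add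
      ((hasDerivAt_derivWeierstrassP hw).div_const 2)).sub ((hasDerivAt_id w).const_mul (L.g₂ / 12))
    convert! h1.sub h2 using 1
    rw [h.deformP_eq hw]
    ring
  · have := (L.tendsto_deformZeta φ).sub
      (((((L.tendsto_weierstrassZetaExcept_div.mul tendsto_id_nhdsNE_zero).add
      (L.tendsto_weierstrassPExcept_div.mul tendsto_id_nhdsNE_zero)).add
      (L.tendsto_weierstrassZetaExcept.mul L.tendsto_weierstrassPExcept)).add
      (L.tendsto_derivWeierstrassPExcept.div_const 2)).sub
      (tendsto_id_nhdsNE_zero.const_mul (L.g₂ / 12)))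
    simp only [mul_zero, add_zero, zero_div, sub_zero] at this
    refine this.congr' ?_
    filter_upwards [self_mem_nhdsWithin] with w hw
    have hw0 : w ≠ 0 := hw
    rw [weierstrassZeta_eq, weierstrassP_eq, derivWeierstrassP_eq]
    field_simp
    ring

theorem IsQuasiPeriodMap.deformSigma_eq (h : L.IsQuasiPeriodMap φ) {z : ℂ} (hz : z ∉ L.lattice) :
    L.deformSigma φ z = (L.weierstrassP z - L.weierstrassZeta z ^ 2 - L.g₂ / 12 * z ^ 2) / 2 := by
  rw [← sub_eq_zero]
  refine eq_zero_of_hasDerivAt_zero (L := L) (f := fun z => L.deformSigma φ z -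
    (L.weierstrassP z - L.weierstrassZeta z ^ 2 - L.g₂ / 12 * z ^ 2) / 2) ?_ ?_ hz
  · intro w hw
    have h1 := (L.hasSum_deformSigma_and_hasDerivAt φ (z := w) fun h => hw h.1).2
    have h2 := (((hasDerivAt_weierstrassP hw).sub ((hasDerivAt_weierstrassZeta hw).pow 2)).sub
      ((hasDerivAt_pow 2 w).const_mul (L.g₂ / 12))).div_const 2
    convert! h1.sub h2 using 1
    rw [h.deformZeta_eq hw]
    push_cast
    ring
  · have := (L.tendsto_deformSigma φ).sub
      ((((L.tendsto_weierstrassPExcept.sub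
      ((L.tendsto_weierstrassZetaExcept_div.mul (tendsto_id_nhdsNE_zero.pow 2)).const_mul 2)).sub
      (L.tendsto_weierstrassZetaExcept.pow 2)).sub
      ((tendsto_id_nhdsNE_zero.pow 2).const_mul (L.g₂ / 12))).div_const 2)
    simp only [ne_eq, OfNat.ofNat_ne_zero, not_false_eq_true, zero_pow, mul_zero, sub_zero,
      zero_div] at this
    refine this.congr' ?_
    filter_upwards [self_mem_nhdsWithin] with w hw
    have hw0 : w ≠ 0 := hw
    rw [weierstrassZeta_eq, weierstrassP_eq]
    field_simp
    ring

/-! ### The scaling deformation -/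

section Scaling

variable {z : ℂ}

/-- Euler's relation for σ, which is homogeneous of degree 1 in z and the periods jointly. It holds
term by term: both series have the terms z³/(l²(l − z)). -/
theorem deformSigma_id (hz : z ∉ L.lattice) :
    L.deformSigma (.id ℝ ℂ) z = 1 - z * L.weierstrassZeta z := by
  have hz0 : z ≠ 0 := fun h => hz (h ▸ zero_mem _)
  rw [weierstrassZeta_eq, mul_add, mul_one_div_cancel hz0, weierstrassZetaExcept, ← tsum_mul_left,
    sub_add_cancel_left, ← tsum_neg, deformSigma]
  congr 1 with l
  simp only [ContinuousLinearMap.coe_id', id]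
  split_ifs with hl
  · simp [hl]
  · have h1 : z - l ≠ 0 := fun h => hz (by rw [sub_eq_zero.mp h]; exact l.2)
    have h2 : (l : ℂ) - z ≠ 0 := by rwa [← neg_sub, neg_ne_zero]
    rw [show (l : ℂ) - z = -(z - l) by ring]
    field_simp
    ring

theorem deformZeta_id (hz : z ∉ L.lattice) :
    L.deformZeta (.id ℝ ℂ) z = z * L.weierstrassP z - L.weierstrassZeta z := by
  have h1 := (L.hasSum_deformSigma_and_hasDerivAt (.id ℝ ℂ) (z := z) fun h => hz h.1).2
  have h2 := ((hasDerivAt_id z).mul (hasDerivAt_weierstrassZeta hz)).const_sub 1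
  rw [h1.unique (h2.congr_of_eventuallyEq ?_)]
  · simp only [id]
    ring
  · filter_upwards [L.isOpen_compl_lattice.mem_nhds hz] with w hw using deformSigma_id hw

theorem deformP_id (hz : z ∉ L.lattice) :
    L.deformP (.id ℝ ℂ) z = -(z * L.derivWeierstrassP z + 2 * L.weierstrassP z) := by
  have h1 := (L.hasSum_deformZeta_and_hasDerivAt (.id ℝ ℂ) (z := z) fun h => hz h.1).2
  have h2 := ((hasDerivAt_id z).mul (hasDerivAt_weierstrassP hz)).sub
    (hasDerivAt_weierstrassZeta hz)
  rw [← neg_inj, h1.unique (h2.congr_of_eventuallyEq ?_)]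
  · simp only [id]
    ring
  · filter_upwards [L.isOpen_compl_lattice.mem_nhds hz] with w hw using deformZeta_id hw

theorem deformDerivP_id (hz : z ∉ L.lattice) :
    L.deformDerivP (.id ℝ ℂ) z = -(z * (6 * L.weierstrassP z ^ 2 - L.g₂ / 2) +
      3 * L.derivWeierstrassP z) := by
  have h1 := (L.hasSum_deformP_and_hasDerivAt (.id ℝ ℂ) (z := z) fun h => hz h.1).2.2
  have h2 := (((hasDerivAt_id z).mul (hasDerivAt_derivWeierstrassP hz)).add
    ((hasDerivAt_weierstrassP hz).const_mul 2)).neg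
  rw [h1.unique (h2.congr_of_eventuallyEq ?_)]
  · simp only [id]
    ring
  · filter_upwards [L.isOpen_compl_lattice.mem_nhds hz] with w hw using deformP_id hw

end Scaling

/-! ### Legendre's relation by Cauchy's theorem on the centred parallelogram -/

variable (L : PeriodPair)

theorem eq_of_mem_lattice {x y : ℝ} (h : (x * L.ω₁ + y * L.ω₂ : ℂ) ∈ L.lattice) :
    ∃ m n : ℤ, x = m ∧ y = n := by
  obtain ⟨m, n, e⟩ := mem_lattice.mp h
  have := LinearIndependent.pair_iff.mp L.indep (x - m) (y - n)
    (by simp only [Complex.real_smul]; push_cast; linear_combination -e)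
  exact ⟨m, n, by linarith [this.1], by linarith [this.2]⟩

/-- An integer of absolute value at most 1/2 is 0. Centring the parallelogram thus leaves 0 as its
only period, and ζ − 1/z is holomorphic on all of it, boundary included. -/
theorem notMem_lattice_sdiff_of_abs_le {x y : ℝ} (hx : |x| ≤ 1 / 2) (hy : |y| ≤ 1 / 2) :
    (x * L.ω₁ + y * L.ω₂ : ℂ) ∈ ((L.lattice : Set ℂ) \ {0})ᶜ := by
  rintro ⟨h, h0⟩
  have key : ∀ k : ℤ, |(k : ℝ)| ≤ 1 / 2 → (k : ℝ) = 0 := by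
    intro k hk
    have h1 : |(k : ℝ)| < 1 := by linarith
    rw [← Int.cast_abs] at h1
    rw [Int.abs_lt_one_iff.mp (show |k| < 1 by exact_mod_cast h1), Int.cast_zero]
  obtain ⟨m, n, rfl, rfl⟩ := L.eq_of_mem_lattice h
  refine h0 ?_
  rw [key m hx, key n hy]
  simp

theorem notMem_lattice_of_eq_half {x y : ℝ}
    (hxy : x = 1 / 2 ∨ x = -(1 / 2) ∨ y = 1 / 2 ∨ y = -(1 / 2)) :
    (x * L.ω₁ + y * L.ω₂ : ℂ) ∉ L.lattice := by
  intro h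
  have key : ∀ k : ℤ, (k : ℝ) ≠ 1 / 2 ∧ (k : ℝ) ≠ -(1 / 2) := by
    intro k
    constructor
    · intro hk
      have : (2 * k : ℝ) = 1 := by linarith
      have : 2 * k = 1 := by exact_mod_cast this
      omega
    · intro hk
      have : (2 * k : ℝ) = -1 := by linarith
      have : 2 * k = -1 := by exact_mod_cast this
      omega
  obtain ⟨m, n, rfl, rfl⟩ := L.eq_of_mem_lattice h
  have hm := key m
  have hn := key n
  tauto

/-- Cauchy's theorem for the regular part of `ζ` on the centred period parallelogram. -/
theorem parallelogram_integral_weierstrassZetaExcept :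
    L.ω₁ * ((∫ x : ℝ in (-(1 / 2))..(1 / 2),
        L.weierstrassZetaExcept (x * L.ω₁ + (1 / 2 : ℝ) * L.ω₂)) -
      ∫ x : ℝ in (-(1 / 2))..(1 / 2),
        L.weierstrassZetaExcept (x * L.ω₁ + (-(1 / 2) : ℝ) * L.ω₂)) =
    L.ω₂ * ((∫ y : ℝ in (-(1 / 2))..(1 / 2),
        L.weierstrassZetaExcept ((1 / 2 : ℝ) * L.ω₁ + y * L.ω₂)) -
      ∫ y : ℝ in (-(1 / 2))..(1 / 2),
        L.weierstrassZetaExcept ((-(1 / 2) : ℝ) * L.ω₁ + y * L.ω₂)) := by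
  set Z : ℝ × ℝ →L[ℝ] ℂ :=
    (ContinuousLinearMap.fst ℝ ℝ ℝ).smulRight L.ω₁ + (ContinuousLinearMap.snd ℝ ℝ ℝ).smulRight L.ω₂
    with hZ
  have hZa : ∀ p : ℝ × ℝ, Z p = p.1 * L.ω₁ + p.2 * L.ω₂ := by
    intro p
    simp [hZ]
  have hder : ∀ c : ℂ, ∀ p : ℝ × ℝ, |p.1| ≤ 1 / 2 → |p.2| ≤ 1 / 2 →
      HasFDerivAt (fun p => c * L.weierstrassZetaExcept (Z p))
        ((-L.weierstrassPExcept 0 (Z p)) • (c • Z)) p := by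
    intro c p h1 h2
    have h := (L.hasDerivAt_weierstrassZetaExcept (z := Z p)
      (by rw [hZa]; exact L.notMem_lattice_sdiff_of_abs_le h1 h2)).hasFDerivAt.restrictScalars ℝ
    have := (h.comp p Z.hasFDerivAt).const_mul c
    convert! this using 1
    ext <;> simp <;> ring
  have huIcc : Set.uIcc (-(1 / 2) : ℝ) (1 / 2) = Set.Icc (-(1 / 2)) (1 / 2) :=
    Set.uIcc_of_le (by norm_num)
  have hcont : ∀ c : ℂ, ContinuousOn (fun p => c * L.weierstrassZetaExcept (Z p))
      (Set.uIcc (-(1 / 2) : ℝ) (1 / 2) ×ˢ Set.uIcc (-(1 / 2) : ℝ) (1 / 2)) := by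
    intro c p hp
    rw [huIcc] at hp
    exact (hder c p (abs_le.mpr hp.1) (abs_le.mpr hp.2)).continuousAt.continuousWithinAt
  have hmem : ∀ p ∈ Set.Ioo (min (-(1 / 2)) (1 / 2) : ℝ) (max (-(1 / 2)) (1 / 2)) ×ˢ
      Set.Ioo (min (-(1 / 2)) (1 / 2) : ℝ) (max (-(1 / 2)) (1 / 2)) \ (∅ : Set (ℝ × ℝ)),
      |p.1| ≤ 1 / 2 ∧ |p.2| ≤ 1 / 2 := by
    rintro p ⟨⟨h1, h2⟩, -⟩
    rw [min_eq_left (by norm_num), max_eq_right (by norm_num)] at h1 h2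
    exact ⟨abs_le.mpr ⟨h1.1.le, h1.2.le⟩, abs_le.mpr ⟨h2.1.le, h2.2.le⟩⟩
  -- The field is (ω₂h, −ω₁h) with h the regular part of ζ in the coordinates (x, y). Since h is
  -- holomorphic, its divergence is h'·(ω₂ω₁ − ω₁ω₂) = 0.
  have hzero : ∀ p : ℝ × ℝ,
      ((-L.weierstrassPExcept 0 (Z p)) • (L.ω₂ • Z)) (1, 0) +
        ((-L.weierstrassPExcept 0 (Z p)) • ((-L.ω₁) • Z)) (0, 1) = 0 := by
    intro p
    simp only [smul_apply, hZa, smul_eq_mul]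
    push_cast
    ring
  have key := MeasureTheory.integral2_divergence_prod_of_hasFDerivAt_off_countable
    _ _ _ _ (-(1 / 2)) (-(1 / 2)) (1 / 2) (1 / 2) ∅ Set.countable_empty
    (hcont L.ω₂) (hcont (-L.ω₁))
    (fun p hp => hder _ p (hmem p hp).1 (hmem p hp).2)
    (fun p hp => hder _ p (hmem p hp).1 (hmem p hp).2)
    (by simp only [hzero]; exact MeasureTheory.integrableOn_zero)
  simp only [hzero] at key
  simp only [intervalIntegral.integral_zero, intervalIntegral.integral_const_mul, hZa] at key
  linear_combination key

/-- The factor `k` rotates the segment off the branch cut and drops out of the logarithmic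
derivative. -/
theorem integral_div_affine {p q k : ℂ} {a b : ℝ}
    (h : ∀ x ∈ Set.uIcc a b, k * (p + x * q) ∈ Complex.slitPlane) :
    ∫ x : ℝ in a..b, q / (p + x * q) =
      Complex.log (k * (p + b * q)) - Complex.log (k * (p + a * q)) := by
  have hne : ∀ x ∈ Set.uIcc a b, k * (p + x * q) ≠ 0 := fun x hx =>
    Complex.slitPlane_ne_zero (h x hx)
  refine intervalIntegral.integral_eq_sub_of_hasDerivAt
    (f := fun x : ℝ => Complex.log (k * (p + x * q))) ?_ ?_
  · intro x hx
    have h1 : HasDerivAt (fun x : ℝ => k * (p + x * q)) (k * q) x := by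
      simpa using (((Complex.ofRealCLM.hasDerivAt (x := x)).mul_const q).const_add p).const_mul k
    convert! h1.clog_real (h x hx) using 1
    have := hne x hx
    rw [mul_div_mul_left _ _ (left_ne_zero_of_mul this)]
  · refine ContinuousOn.intervalIntegrable fun x hx => ?_
    have := right_ne_zero_of_mul (hne x hx)
    have h1 : ContinuousAt (fun x : ℝ => p + x * q) x := by fun_prop
    exact (continuousAt_const.div h1 this).continuousWithinAt

/-- The integral of `1/z` along two consecutive sides of the centred period parallelogram. -/
theorem integral_inv_two_sides {s : ℝ} (hs : s = 1 ∨ s = -1) (h : 0 < s * (L.ω₂ / L.ω₁).im) :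
    (∫ x : ℝ in (-(1 / 2))..(1 / 2), L.ω₁ / (-(L.ω₂ / 2) + x * L.ω₁)) +
      (∫ y : ℝ in (-(1 / 2))..(1 / 2), L.ω₂ / (L.ω₁ / 2 + y * L.ω₂)) =
        s * (Real.pi * Complex.I) := by
  have huIcc : Set.uIcc (-(1 / 2) : ℝ) (1 / 2) = Set.Icc (-(1 / 2)) (1 / 2) :=
    Set.uIcc_of_le (by norm_num)
  have h₁ : L.ω₁ ≠ 0 := by
    intro h0
    simp [h0] at h
  -- The two sides form a path from the corner −c to the corner c. Divided by c it runs −1, −1 + a,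
  -- 1, with a = ω₁/c, and stays on the side of the real axis given by the sign of Im a, which is
  -- −s.
  set c : ℂ := (L.ω₁ + L.ω₂) / 2 with hc
  have hc0 : c ≠ 0 := by
    intro h0
    have : L.ω₂ / L.ω₁ = -1 := by
      field_simp
      linear_combination 2 * h0
    simp [this] at h
  set a : ℂ := L.ω₁ / c with ha
  have ha0 : a ≠ 0 := div_ne_zero h₁ hc0
  have ha2 : L.ω₂ / c = 2 - a := by
    rw [ha]
    field_simp
    linear_combination (-2) * hc
  have him : s * a.im < 0 := by
    have e : L.ω₂ / L.ω₁ = 2 * a⁻¹ - 1 := by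
      have : L.ω₂ / L.ω₁ = (L.ω₂ / c) / a := by
        rw [ha]
        field_simp
      rw [this, ha2]
      field_simp
    have e2 : (L.ω₂ / L.ω₁).im = -(2 * a.im / Complex.normSq a) := by
      rw [e]
      simp [Complex.inv_im]
      ring
    have hn : 0 < Complex.normSq a := Complex.normSq_pos.mpr ha0
    rw [e2] at h
    have e3 : s * -(2 * a.im / Complex.normSq a) * Complex.normSq a = -(2 * (s * a.im)) := by
      field_simp
    have := mul_pos h hn
    linarith
  -- Multiplication by i·s turns that side into the right half-plane, with the endpoints at ∓i·s.
  -- One branch of the logarithm then covers both sides, and its increment is sπi.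
  set k : ℂ := Complex.I * s / c with hk
  have hslit : ∀ u : ℝ, 0 ≤ u → ∀ e : ℂ, e = 1 ∨ e = -1 →
      Complex.I * s * (e + u * a) ∈ Complex.slitPlane := by
    intro u hu e he
    rw [Complex.mem_slitPlane_iff]
    have hei : e.im = 0 := by rcases he with rfl | rfl <;> simp
    rcases hu.eq_or_lt with rfl | hu
    · right
      rcases he with rfl | rfl <;> rcases hs with rfl | rfl <;> simp
    · left
      have : (Complex.I * s * (e + u * a)).re = -u * (s * a.im) := by
        simp [hei]
        ring
      rw [this]
      nlinarith
  have hseg₁ : ∀ x ∈ Set.uIcc (-(1 / 2) : ℝ) (1 / 2),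
      k * (-(L.ω₂ / 2) + x * L.ω₁) ∈ Complex.slitPlane := by
    intro x hx
    rw [huIcc] at hx
    have e : k * (-(L.ω₂ / 2) + x * L.ω₁) = Complex.I * s * (-1 + (x + 1 / 2 : ℝ) * a) := by
      rw [hk, ha]
      push_cast
      field_simp
      rw [hc]
      ring
    rw [e]
    exact hslit _ (by linarith [hx.1]) _ (Or.inr rfl)
  have hseg₂ : ∀ y ∈ Set.uIcc (-(1 / 2) : ℝ) (1 / 2),
      k * (L.ω₁ / 2 + y * L.ω₂) ∈ Complex.slitPlane := by
    intro y hy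
    rw [huIcc] at hy
    have e : k * (L.ω₁ / 2 + y * L.ω₂) =
        Complex.I * s * ((2 * y : ℝ) + (1 / 2 - y : ℝ) * a) := by
      have : L.ω₂ = c * (2 - a) := by rw [← ha2]; field_simp
      have h₁' : L.ω₁ = c * a := by rw [ha]; field_simp
      rw [hk, this, h₁']
      push_cast
      field_simp
      ring
    have e' : Complex.I * s * ((2 * y : ℝ) + (1 / 2 - y : ℝ) * a) ∈ Complex.slitPlane := by
      rw [Complex.mem_slitPlane_iff]
      rcases hy.2.eq_or_lt with rfl | hy2
      · right
        rcases hs with rfl | rfl <;> simp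
      · left
        have : (Complex.I * s * ((2 * y : ℝ) + (1 / 2 - y : ℝ) * a)).re =
            -(1 / 2 - y) * (s * a.im) := by
          simp
          ring
        rw [this]
        nlinarith
    rwa [e]
  rw [integral_div_affine hseg₁, integral_div_affine hseg₂]
  have e1 : k * (-(L.ω₂ / 2) + ((1 / 2 : ℝ) : ℂ) * L.ω₁) =
      k * (L.ω₁ / 2 + ((-(1 / 2) : ℝ) : ℂ) * L.ω₂) := by
    push_cast
    ring
  have e2 : k * (-(L.ω₂ / 2) + ((-(1 / 2) : ℝ) : ℂ) * L.ω₁) = -(Complex.I * s) := by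
    rw [hk]
    field_simp
    rw [hc]
    push_cast
    ring
  have e3 : k * (L.ω₁ / 2 + ((1 / 2 : ℝ) : ℂ) * L.ω₂) = Complex.I * s := by
    rw [hk]
    field_simp
    rw [hc]
    push_cast
    ring
  rw [e1, e2, e3]
  rcases hs with rfl | rfl
  · simp [Complex.log_I, Complex.log_neg_I]
    ring
  · simp [Complex.log_I, Complex.log_neg_I]
    ring

/-- The Legendre relation. -/
theorem legendre_relation {s : ℝ} (hs : s = 1 ∨ s = -1) (h : 0 < s * (L.ω₂ / L.ω₁).im) :
    2 * L.weierstrassZeta (L.ω₁ / 2) * L.ω₂ - 2 * L.weierstrassZeta (L.ω₂ / 2) * L.ω₁ =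
      2 * s * (Real.pi * Complex.I) := by
  have huIcc : Set.uIcc (-(1 / 2) : ℝ) (1 / 2) = Set.Icc (-(1 / 2)) (1 / 2) :=
    Set.uIcc_of_le (by norm_num)
  have hne : ∀ x y : ℝ, (x = 1 / 2 ∨ x = -(1 / 2) ∨ y = 1 / 2 ∨ y = -(1 / 2)) →
      (x * L.ω₁ + y * L.ω₂ : ℂ) ≠ 0 := fun x y hxy h0 =>
    L.notMem_lattice_of_eq_half hxy (h0 ▸ zero_mem _)
  have hcont : ∀ (x y : ℝ → ℝ), Continuous x → Continuous y →
      (∀ t ∈ Set.Icc (-(1 / 2) : ℝ) (1 / 2), |x t| ≤ 1 / 2 ∧ |y t| ≤ 1 / 2) →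
      IntervalIntegrable (fun t : ℝ => L.weierstrassZetaExcept (x t * L.ω₁ + y t * L.ω₂))
        MeasureTheory.volume (-(1 / 2)) (1 / 2) := by
    intro x y hx hy hxy
    refine ContinuousOn.intervalIntegrable fun t ht => ?_
    rw [huIcc] at ht
    have h1 := (L.hasDerivAt_weierstrassZetaExcept (L.notMem_lattice_sdiff_of_abs_le
      (hxy t ht).1 (hxy t ht).2)).continuousAt
    have h2 : ContinuousAt (fun t : ℝ => (x t * L.ω₁ + y t * L.ω₂ : ℂ)) t := by fun_prop
    exact (ContinuousAt.comp (f := fun t : ℝ => (x t * L.ω₁ + y t * L.ω₂ : ℂ)) h1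
      h2).continuousWithinAt
  have habs : ∀ t ∈ Set.Icc (-(1 / 2) : ℝ) (1 / 2), |t| ≤ 1 / 2 := fun t ht => abs_le.mpr ht
  have habs1 : |(1 / 2 : ℝ)| ≤ 1 / 2 := by norm_num
  have habs2 : |(-(1 / 2) : ℝ)| ≤ 1 / 2 := by norm_num
  have hint : ∀ p q : ℂ, (∀ x : ℝ, p + x * q ≠ 0) →
      IntervalIntegrable (fun x : ℝ => q / (p + x * q))
        MeasureTheory.volume (-(1 / 2)) (1 / 2) := by
    intro p q hpq
    exact (Continuous.div (by fun_prop) (by fun_prop) hpq).intervalIntegrable _ _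
  have hc : ∀ c : ℂ, IntervalIntegrable (fun _ : ℝ => c) MeasureTheory.volume
      (-(1 / 2)) (1 / 2) := fun c => continuous_const.intervalIntegrable _ _
  -- The symmetry z ↦ −z of the parallelogram reduces the 1/z integrals over four sides to two
  -- consecutive ones.
  have hrefl : ∀ p q : ℂ, ∫ x : ℝ in (-(1 / 2))..(1 / 2), q / (p + x * q) =
      -∫ x : ℝ in (-(1 / 2))..(1 / 2), q / (-p + x * q) := by
    intro p q
    rw [← intervalIntegral.integral_neg]
    have := intervalIntegral.integral_comp_neg (a := -(1 / 2)) (b := 1 / 2)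
      (fun x : ℝ => -(q / (-p + x * q)))
    rw [neg_neg] at this
    rw [← this]
    congr 1 with x
    rw [← div_neg]
    push_cast
    congr 1
    ring
  have key := L.parallelogram_integral_weierstrassZetaExcept
  have i1 : IntervalIntegrable (fun x : ℝ => L.weierstrassZetaExcept
      (x * L.ω₁ + (1 / 2 : ℝ) * L.ω₂)) MeasureTheory.volume (-(1 / 2)) (1 / 2) :=
    hcont _ _ continuous_id continuous_const fun t ht => ⟨habs t ht, habs1⟩
  have i2 : IntervalIntegrable (fun x : ℝ => L.weierstrassZetaExcept
      (x * L.ω₁ + (-(1 / 2) : ℝ) * L.ω₂)) MeasureTheory.volume (-(1 / 2)) (1 / 2) :=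
    hcont _ _ continuous_id continuous_const fun t ht => ⟨habs t ht, habs2⟩
  have i3 : IntervalIntegrable (fun y : ℝ => L.weierstrassZetaExcept
      ((1 / 2 : ℝ) * L.ω₁ + y * L.ω₂)) MeasureTheory.volume (-(1 / 2)) (1 / 2) :=
    hcont _ _ continuous_const continuous_id fun t ht => ⟨habs1, habs t ht⟩
  have i4 : IntervalIntegrable (fun y : ℝ => L.weierstrassZetaExcept
      ((-(1 / 2) : ℝ) * L.ω₁ + y * L.ω₂)) MeasureTheory.volume (-(1 / 2)) (1 / 2) :=
    hcont _ _ continuous_const continuous_id fun t ht => ⟨habs2, habs t ht⟩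
  rw [← intervalIntegral.integral_sub i1 i2, ← intervalIntegral.integral_sub i3 i4,
    ← intervalIntegral.integral_const_mul, ← intervalIntegral.integral_const_mul] at key
  have n1 : ∀ x : ℝ, -(L.ω₂ / 2) + x * L.ω₁ ≠ 0 := fun x h0 =>
    hne x (-(1 / 2)) (by simp) (by push_cast; linear_combination h0)
  have n2 : ∀ x : ℝ, L.ω₂ / 2 + x * L.ω₁ ≠ 0 := fun x h0 =>
    hne x (1 / 2) (by simp) (by push_cast; linear_combination h0)
  have n3 : ∀ y : ℝ, L.ω₁ / 2 + y * L.ω₂ ≠ 0 := fun y h0 =>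
    hne (1 / 2) y (by simp) (by push_cast; linear_combination h0)
  have n4 : ∀ y : ℝ, -(L.ω₁ / 2) + y * L.ω₂ ≠ 0 := fun y h0 =>
    hne (-(1 / 2)) y (by simp) (by push_cast; linear_combination h0)
  -- On opposite sides ζ differs by a constant quasi-period, so the regular parts differ by that
  -- constant and two terms 1/z.
  have f1 : ∀ x : ℝ, L.ω₁ * (L.weierstrassZetaExcept (x * L.ω₁ + (1 / 2 : ℝ) * L.ω₂) -
      L.weierstrassZetaExcept (x * L.ω₁ + (-(1 / 2) : ℝ) * L.ω₂)) =
      L.ω₁ * (2 * L.weierstrassZeta (L.ω₂ / 2)) - L.ω₁ / (L.ω₂ / 2 + x * L.ω₁) +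
        L.ω₁ / (-(L.ω₂ / 2) + x * L.ω₁) := by
    intro x
    have h1 := weierstrassZeta_add L.ω₂_mem_lattice L.ω₂_div_two_notMem_lattice
      (L.notMem_lattice_of_eq_half (x := x) (y := -(1 / 2)) (by simp))
    rw [weierstrassZeta_eq, weierstrassZeta_eq] at h1
    rw [show (x * L.ω₁ + (-(1 / 2) : ℝ) * L.ω₂ + L.ω₂ : ℂ) = x * L.ω₁ + (1 / 2 : ℝ) * L.ω₂ by
      push_cast; ring] at h1
    rw [show L.ω₂ / 2 + x * L.ω₁ = x * L.ω₁ + (1 / 2 : ℝ) * L.ω₂ by push_cast; ring,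
      show -(L.ω₂ / 2) + x * L.ω₁ = x * L.ω₁ + (-(1 / 2) : ℝ) * L.ω₂ by push_cast; ring]
    linear_combination L.ω₁ * h1
  have f2 : ∀ y : ℝ, L.ω₂ * (L.weierstrassZetaExcept ((1 / 2 : ℝ) * L.ω₁ + y * L.ω₂) -
      L.weierstrassZetaExcept ((-(1 / 2) : ℝ) * L.ω₁ + y * L.ω₂)) =
      L.ω₂ * (2 * L.weierstrassZeta (L.ω₁ / 2)) - L.ω₂ / (L.ω₁ / 2 + y * L.ω₂) +
        L.ω₂ / (-(L.ω₁ / 2) + y * L.ω₂) := by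
    intro y
    have h1 := weierstrassZeta_add L.ω₁_mem_lattice L.ω₁_div_two_notMem_lattice
      (L.notMem_lattice_of_eq_half (x := -(1 / 2)) (y := y) (by simp))
    rw [weierstrassZeta_eq, weierstrassZeta_eq] at h1
    rw [show ((-(1 / 2) : ℝ) * L.ω₁ + y * L.ω₂ + L.ω₁ : ℂ) = (1 / 2 : ℝ) * L.ω₁ + y * L.ω₂ by
      push_cast; ring] at h1
    rw [show L.ω₁ / 2 + y * L.ω₂ = (1 / 2 : ℝ) * L.ω₁ + y * L.ω₂ by push_cast; ring,
      show -(L.ω₁ / 2) + y * L.ω₂ = (-(1 / 2) : ℝ) * L.ω₁ + y * L.ω₂ by push_cast; ring]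
    linear_combination L.ω₂ * h1
  simp only [f1, f2] at key
  rw [intervalIntegral.integral_add ((hc _).sub (hint _ _ n2))
      (hint _ _ n1),
    intervalIntegral.integral_sub (hc _) (hint _ _ n2),
    intervalIntegral.integral_add ((hc _).sub (hint _ _ n3))
      (hint _ _ n4),
    intervalIntegral.integral_sub (hc _) (hint _ _ n3),
    intervalIntegral.integral_const, intervalIntegral.integral_const, hrefl (L.ω₂ / 2) L.ω₁,
    hrefl (-(L.ω₁ / 2)) L.ω₂, neg_neg, show (1 / 2 - -(1 / 2) : ℝ) = 1 by norm_num, one_smul,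
    one_smul] at key
  linear_combination 2 * L.integral_inv_two_sides hs h - key

/-! ### Linearity of the deformation series in the direction -/

section Linearity

variable {L : PeriodPair} {φ ψ : ℂ →L[ℝ] ℂ} {a b z : ℂ}

theorem apply_coe_lattice_eq_of_periods (h₁ : φ L.ω₁ = a * L.ω₁ + b * ψ L.ω₁)
    (h₂ : φ L.ω₂ = a * L.ω₂ + b * ψ L.ω₂) (l : L.lattice) : φ l = a * l + b * ψ l := by
  have hid := L.apply_coe_lattice (.id ℝ ℂ) l
  simp only [ContinuousLinearMap.coe_id', id] at hid
  rw [L.apply_coe_lattice φ, L.apply_coe_lattice ψ, h₁, h₂]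
  linear_combination (-a) * hid

theorem deformSigma_eq_of_periods (h₁ : φ L.ω₁ = a * L.ω₁ + b * ψ L.ω₁)
    (h₂ : φ L.ω₂ = a * L.ω₂ + b * ψ L.ω₂) (hz : z ∉ L.lattice) :
    L.deformSigma φ z = a * L.deformSigma (.id ℝ ℂ) z + b * L.deformSigma ψ z := by
  have hz' : z ∈ ((L.lattice : Set ℂ) \ {0})ᶜ := fun h => hz h.1
  refine HasSum.tsum_eq ?_
  convert! ((L.hasSum_deformSigma_and_hasDerivAt (.id ℝ ℂ) hz').1.mul_left a).add
    ((L.hasSum_deformSigma_and_hasDerivAt ψ hz').1.mul_left b) using 1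
  ext l
  rw [apply_coe_lattice_eq_of_periods h₁ h₂]
  simp only [ContinuousLinearMap.coe_id', id]
  ring

theorem deformZeta_eq_of_periods (h₁ : φ L.ω₁ = a * L.ω₁ + b * ψ L.ω₁)
    (h₂ : φ L.ω₂ = a * L.ω₂ + b * ψ L.ω₂) (hz : z ∉ L.lattice) :
    L.deformZeta φ z = a * L.deformZeta (.id ℝ ℂ) z + b * L.deformZeta ψ z := by
  have hz' : z ∈ ((L.lattice : Set ℂ) \ {0})ᶜ := fun h => hz h.1
  refine HasSum.tsum_eq ?_
  convert! ((L.hasSum_deformZeta_and_hasDerivAt (.id ℝ ℂ) hz').1.mul_left a).add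
    ((L.hasSum_deformZeta_and_hasDerivAt ψ hz').1.mul_left b) using 1
  ext l
  rw [apply_coe_lattice_eq_of_periods h₁ h₂]
  simp only [ContinuousLinearMap.coe_id', id]
  ring

theorem deformP_eq_of_periods (h₁ : φ L.ω₁ = a * L.ω₁ + b * ψ L.ω₁)
    (h₂ : φ L.ω₂ = a * L.ω₂ + b * ψ L.ω₂) (hz : z ∉ L.lattice) :
    L.deformP φ z = a * L.deformP (.id ℝ ℂ) z + b * L.deformP ψ z := by
  have hz' : z ∈ ((L.lattice : Set ℂ) \ {0})ᶜ := fun h => hz h.1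
  refine HasSum.tsum_eq ?_
  convert! ((L.hasSum_deformP_and_hasDerivAt (.id ℝ ℂ) hz').1.mul_left a).add
    ((L.hasSum_deformP_and_hasDerivAt ψ hz').1.mul_left b) using 1
  ext l
  rw [apply_coe_lattice_eq_of_periods h₁ h₂]
  simp only [ContinuousLinearMap.coe_id', id]
  ring

theorem deformDerivP_eq_of_periods (h₁ : φ L.ω₁ = a * L.ω₁ + b * ψ L.ω₁)
    (h₂ : φ L.ω₂ = a * L.ω₂ + b * ψ L.ω₂) (hz : z ∉ L.lattice) :
    L.deformDerivP φ z = a * L.deformDerivP (.id ℝ ℂ) z + b * L.deformDerivP ψ z := by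
  have hz' : z ∈ ((L.lattice : Set ℂ) \ {0})ᶜ := fun h => hz h.1
  refine HasSum.tsum_eq ?_
  convert! ((L.hasSum_deformP_and_hasDerivAt (.id ℝ ℂ) hz').2.1.mul_left a).add
    ((L.hasSum_deformP_and_hasDerivAt ψ hz').2.1.mul_left b) using 1
  ext l
  rw [apply_coe_lattice_eq_of_periods h₁ h₂]
  simp only [ContinuousLinearMap.coe_id', id]
  ring

end Linearity

end PeriodPair

/-! ### Passage to half-periods -/

section HalfPeriods

variable {ω ω' : ℂ}

theorem periodsOfHalfPeriods_eq (h : (ω' / ω).im ≠ 0) :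
    (periodsOfHalfPeriods ω ω').ω₁ = 2 * ω ∧ (periodsOfHalfPeriods ω ω').ω₂ = 2 * ω' := by
  rw [periodsOfHalfPeriods, dif_pos h]
  exact ⟨rfl, rfl⟩

/-- A non-real ratio stays non-real under small changes, so the placeholder lattice is not met near
ω. The value 2 appears because the period is 2ω. -/
theorem isDeformation_left (h : (ω' / ω).im ≠ 0) {φ : ℂ →L[ℝ] ℂ}
    (h₁ : φ (periodsOfHalfPeriods ω ω').ω₁ = 2) (h₂ : φ (periodsOfHalfPeriods ω ω').ω₂ = 0) :
    ∀ᶠ w in 𝓝 ω, (periodsOfHalfPeriods ω ω').IsDeformation (periodsOfHalfPeriods w ω') φ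
      (w - ω) := by
  have hω : ω ≠ 0 := by
    rintro rfl
    simp at h
  have hc : ContinuousAt (fun w => (ω' / w).im) ω :=
    Complex.continuous_im.continuousAt.comp (continuousAt_const.div continuousAt_id hω)
  filter_upwards [hc.eventually_ne h] with w hw
  rw [PeriodPair.IsDeformation, h₁, h₂, (periodsOfHalfPeriods_eq h).1,
    (periodsOfHalfPeriods_eq h).2, (periodsOfHalfPeriods_eq hw).1, (periodsOfHalfPeriods_eq hw).2]
  constructor <;> ring

theorem isDeformation_right (h : (ω' / ω).im ≠ 0) {φ : ℂ →L[ℝ] ℂ}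
    (h₁ : φ (periodsOfHalfPeriods ω ω').ω₁ = 0) (h₂ : φ (periodsOfHalfPeriods ω ω').ω₂ = 2) :
    ∀ᶠ w in 𝓝 ω', (periodsOfHalfPeriods ω ω').IsDeformation (periodsOfHalfPeriods ω w) φ
      (w - ω') := by
  have hc : ContinuousAt (fun w => (w / ω).im) ω' :=
    Complex.continuous_im.continuousAt.comp (continuousAt_id.div_const ω)
  filter_upwards [hc.eventually_ne h] with w hw
  rw [PeriodPair.IsDeformation, h₁, h₂, (periodsOfHalfPeriods_eq h).1,
    (periodsOfHalfPeriods_eq h).2, (periodsOfHalfPeriods_eq hw).1, (periodsOfHalfPeriods_eq hw).2]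
  constructor <;> ring

/-- The Legendre relation in terms of half-periods. -/
theorem legendre_relation_halfPeriods (h : (ω' / ω).im ≠ 0) :
    2 * (wη ω ω' * ω' - wη' ω ω' * ω) = Real.sign (ω' / ω).im * (Real.pi * Complex.I) := by
  obtain ⟨e1, e2⟩ := periodsOfHalfPeriods_eq h
  have e : (periodsOfHalfPeriods ω ω').ω₂ / (periodsOfHalfPeriods ω ω').ω₁ = ω' / ω := by
    rw [e1, e2, mul_div_mul_left _ _ two_ne_zero]
  have := (periodsOfHalfPeriods ω ω').legendre_relation (s := Real.sign (ω' / ω).im) ?_ ?_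
  · rw [e1, e2, mul_div_cancel_left₀ _ two_ne_zero, mul_div_cancel_left₀ _ two_ne_zero] at this
    simp only [wη, wη', wζ]
    linear_combination this / 2
  · rcases h.lt_or_gt with h | h
    · exact Or.inr (Real.sign_of_neg h)
    · exact Or.inl (Real.sign_of_pos h)
  · rw [e]
    exact Real.sign_mul_pos_of_ne_zero _ h

end HalfPeriods

end

/-! ### Assembly of the derivative formulas -/

theorem theorem10p1 :
    -- derivatives in the half-periods
    (∀ z ω ω' : ℂ, (ω' / ω).im ≠ 0 →
      (∀ m n : ℤ, z ≠ 2 * m * ω + 2 * n * ω') →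
      ∀ s σ ζ P P' g₂ η η' : ℂ,
        s = (Real.sign (ω' / ω).im : ℂ) →
        σ = wσ z ω ω' → ζ = wζ z ω ω' → P = wP z ω ω' → P' = wP' z ω ω' →
        g₂ = wg₂ ω ω' → η = wη ω ω' → η' = wη' ω ω' →
        ∃ σ₁ σ₂ ζ₁ ζ₂ P₁ P₂ P'₁ P'₂ : ℂ,
          -- the partial derivatives in `ω` (index 1) and in `ω'` (index 2) exist
          (HasDerivAt (fun w => wσ z w ω') σ₁ ω ∧ HasDerivAt (fun w => wσ z ω w) σ₂ ω' ∧
            HasDerivAt (fun w => wζ z w ω') ζ₁ ω ∧ HasDerivAt (fun w => wζ z ω w) ζ₂ ω' ∧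
            HasDerivAt (fun w => wP z w ω') P₁ ω ∧ HasDerivAt (fun w => wP z ω w) P₂ ω' ∧
            HasDerivAt (fun w => wP' z w ω') P'₁ ω ∧ HasDerivAt (fun w => wP' z ω w) P'₂ ω') ∧
          s * σ₁ = -(Complex.I / Real.pi) *
            (ω' * (P - ζ ^ 2 - 1 / 12 * g₂ * z ^ 2) + 2 * η' * (z * ζ - 1)) * σ ∧
          s * σ₂ = (Complex.I / Real.pi) *
            (ω * (P - ζ ^ 2 - 1 / 12 * g₂ * z ^ 2) + 2 * η * (z * ζ - 1)) * σ ∧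
          s * ζ₁ = -(Complex.I / Real.pi) *
            (2 * (ω' * ζ - z * η') * P + ω' * (P' - 1 / 6 * g₂ * z) + 2 * η' * ζ) ∧
          s * ζ₂ = (Complex.I / Real.pi) *
            (2 * (ω * ζ - z * η) * P + ω * (P' - 1 / 6 * g₂ * z) + 2 * η * ζ) ∧
          s * P₁ = (Complex.I / Real.pi) *
            (2 * (ω' * ζ - z * η') * P' + 4 * (ω' * P - η') * P - 2 / 3 * ω' * g₂) ∧
          s * P₂ = -(Complex.I / Real.pi) *
            (2 * (ω * ζ - z * η) * P' + 4 * (ω * P - η) * P - 2 / 3 * ω * g₂) ∧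
          s * P'₁ = (Complex.I / Real.pi) *
            (6 * (ω' * P - η') * P' + (ω' * ζ - z * η') * (12 * P ^ 2 - g₂)) ∧
          s * P'₂ = -(Complex.I / Real.pi) *
            (6 * (ω * P - η) * P' + (ω * ζ - z * η) * (12 * P ^ 2 - g₂))) ∧
    -- the system in `τ`, for the half-periods `1` and `τ`
    (∀ z τ : ℂ, 0 < τ.im → (∀ m n : ℤ, z ≠ 2 * m + 2 * n * τ) →
      ∀ σ ζ P P' g₂ η : ℂ,
        σ = wσ z 1 τ → ζ = wζ z 1 τ → P = wP z 1 τ → P' = wP' z 1 τ →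
        g₂ = wg₂ 1 τ → η = wη 1 τ →
        HasDerivAt (fun t => wσ z 1 t) ((Complex.I / Real.pi) *
          (P - ζ ^ 2 + 2 * η * (z * ζ - 1) - 1 / 12 * g₂ * z ^ 2) * σ) τ ∧
        HasDerivAt (fun t => wζ z 1 t) ((Complex.I / Real.pi) *
          (P' + 2 * (ζ - z * η) * P + 2 * η * ζ - 1 / 6 * g₂ * z)) τ ∧
        HasDerivAt (fun t => wP z 1 t) (-(Complex.I / Real.pi) *
          (2 * (ζ - z * η) * P' + 4 * (P - η) * P - 2 / 3 * g₂)) τ ∧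
        HasDerivAt (fun t => wP' z 1 t) (-(Complex.I / Real.pi) *
          (6 * (P - η) * P' + (ζ - z * η) * (12 * P ^ 2 - g₂))) τ) := by
  -- The system in τ is the case ω = 1, ω' = τ, 𝔰 = 1 of the first part, so it may assume that part.
  refine (and_iff_left_of_imp fun main => ?_).mpr ?_
  · intro z τ hτ hz σ ζ P P' g₂ η hσ hζ hP hP' hg₂ hη
    have hτ' : (τ / 1).im ≠ 0 := by rw [div_one]; exact hτ.ne'
    obtain ⟨σ₁, σ₂, ζ₁, ζ₂, P₁, P₂, P'₁, P'₂, ⟨-, d2, -, d4, -, d6, -, d8⟩, -, e2, -, e4, -, e6,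
      -, e8⟩ := main z 1 τ hτ' (by simpa using hz) 1 σ ζ P P' g₂ η (wη' 1 τ)
      (by rw [div_one, Real.sign_of_pos hτ, Complex.ofReal_one]) hσ hζ hP hP' hg₂ hη rfl
    refine ⟨?_, ?_, ?_, ?_⟩
    · convert d2 using 1
      linear_combination -e2
    · convert d4 using 1
      linear_combination -e4
    · convert d6 using 1
      linear_combination -e6
    · convert d8 using 1
      linear_combination -e8
  intro z ω ω' h hz s σ ζ P P' g₂ η η' hs hσ hζ hP hP' hg₂ hη hη'
  set L := periodsOfHalfPeriods ω ω' with hL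
  obtain ⟨e₁, e₂⟩ : L.ω₁ = 2 * ω ∧ L.ω₂ = 2 * ω' := periodsOfHalfPeriods_eq h
  have hzL : z ∉ L.lattice := by
    intro hmem
    obtain ⟨m, n, e⟩ := PeriodPair.mem_lattice.mp hmem
    rw [e₁, e₂] at e
    exact hz m n (by linear_combination -e)
  have hs2 : s * s = 1 := by
    rw [hs, ← Complex.ofReal_mul]
    rcases h.lt_or_gt with h | h
    · simp [Real.sign_of_neg h]
    · simp [Real.sign_of_pos h]
  have hpi : (Real.pi : ℂ) ≠ 0 := Complex.ofReal_ne_zero.mpr Real.pi_ne_zero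
  have hleg : Complex.I / Real.pi * (2 * (η' * ω - η * ω')) = s := by
    have := legendre_relation_halfPeriods h
    rw [← hη, ← hη', ← hs] at this
    rw [show 2 * (η' * ω - η * ω') = -(s * (Real.pi * Complex.I)) by linear_combination -this]
    field_simp
    linear_combination -s * Complex.I_sq
  have q₁ : L.weierstrassZeta (L.ω₁ / 2) = η := by
    rw [e₁, mul_div_cancel_left₀ _ two_ne_zero, hη]
    rfl
  have q₂ : L.weierstrassZeta (L.ω₂ / 2) = η' := by
    rw [e₂, mul_div_cancel_left₀ _ two_ne_zero, hη']
    rfl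
  obtain ⟨ψ, p₁, p₂⟩ := L.exists_apply_periods (2 * η) (2 * η')
  have hψ : L.IsQuasiPeriodMap ψ := ⟨by rw [p₁, q₁], by rw [p₂, q₂]⟩
  obtain ⟨φ, f₁, f₂⟩ := L.exists_apply_periods 2 0
  obtain ⟨χ, x₁, x₂⟩ := L.exists_apply_periods 0 2
  set c : ℂ := Complex.I / Real.pi with hc
  -- Cramer's rule for (2, 0) in the basis (2ω, 2ω'), (2η, 2η'). The determinant comes from
  -- Legendre's relation, and s² = 1 puts s in the numerator. The direction (0, 2) is treated alike.
  have f₁' : φ L.ω₁ = (2 * c * s * η') * L.ω₁ + (-(2 * c * s * ω')) * ψ L.ω₁ := by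
    rw [f₁, p₁, e₁]
    linear_combination (-2 * s) * hleg - 2 * hs2
  have f₂' : φ L.ω₂ = (2 * c * s * η') * L.ω₂ + (-(2 * c * s * ω')) * ψ L.ω₂ := by
    rw [f₂, p₂, e₂]
    ring
  have x₁' : χ L.ω₁ = (-(2 * c * s * η)) * L.ω₁ + (2 * c * s * ω) * ψ L.ω₁ := by
    rw [x₁, p₁, e₁]
    ring
  have x₂' : χ L.ω₂ = (-(2 * c * s * η)) * L.ω₂ + (2 * c * s * ω) * ψ L.ω₂ := by
    rw [x₂, p₂, e₂]
    linear_combination (-2 * s) * hleg - 2 * hs2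
  have hM₁ := isDeformation_left h f₁ f₂
  have hM₂ := isDeformation_right h x₁ x₂
  have rσ : L.weierstrassSigma z = σ := hσ.symm
  have rζ : L.weierstrassZeta z = ζ := hζ.symm
  have rP : L.weierstrassP z = P := hP.symm
  have rP' : L.derivWeierstrassP z = P' := hP'.symm
  have rg₂ : L.g₂ = g₂ := hg₂.symm
  refine ⟨_, _, _, _, _, _, _, _, ⟨
    PeriodPair.hasDerivAt_weierstrassSigma_deformation hM₁ hzL,
    PeriodPair.hasDerivAt_weierstrassSigma_deformation hM₂ hzL,
    PeriodPair.hasDerivAt_weierstrassZeta_deformation hM₁ hzL,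
    PeriodPair.hasDerivAt_weierstrassZeta_deformation hM₂ hzL,
    PeriodPair.hasDerivAt_weierstrassP_deformation hM₁ hzL,
    PeriodPair.hasDerivAt_weierstrassP_deformation hM₂ hzL,
    PeriodPair.hasDerivAt_derivWeierstrassP_deformation hM₁ hzL,
    PeriodPair.hasDerivAt_derivWeierstrassP_deformation hM₂ hzL⟩, ?_, ?_, ?_, ?_, ?_, ?_, ?_, ?_⟩
  · rw [← hL, PeriodPair.deformSigma_eq_of_periods f₁' f₂' hzL, PeriodPair.deformSigma_id hzL,
      hψ.deformSigma_eq hzL, rσ, rζ, rP, rg₂]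
    linear_combination (c * σ * (2 * η' * (1 - z * ζ) -
      ω' * (P - ζ ^ 2 - g₂ / 12 * z ^ 2))) * hs2
  · rw [← hL, PeriodPair.deformSigma_eq_of_periods x₁' x₂' hzL, PeriodPair.deformSigma_id hzL,
      hψ.deformSigma_eq hzL, rσ, rζ, rP, rg₂]
    linear_combination (-(c * σ * (2 * η * (1 - z * ζ) -
      ω * (P - ζ ^ 2 - g₂ / 12 * z ^ 2)))) * hs2
  · rw [← hL, PeriodPair.deformZeta_eq_of_periods f₁' f₂' hzL, PeriodPair.deformZeta_id hzL,
      hψ.deformZeta_eq hzL, rζ, rP, rP', rg₂]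
    linear_combination (2 * c * (η' * (z * P - ζ) - ω' * (ζ * P + P' / 2 - g₂ / 12 * z))) * hs2
  · rw [← hL, PeriodPair.deformZeta_eq_of_periods x₁' x₂' hzL, PeriodPair.deformZeta_id hzL,
      hψ.deformZeta_eq hzL, rζ, rP, rP', rg₂]
    linear_combination (-2 * c * (η * (z * P - ζ) - ω * (ζ * P + P' / 2 - g₂ / 12 * z))) * hs2
  · rw [← hL, PeriodPair.deformP_eq_of_periods f₁' f₂' hzL, PeriodPair.deformP_id hzL,
      hψ.deformP_eq hzL, rζ, rP, rP', rg₂]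
    linear_combination (-2 * c * (η' * (z * P' + 2 * P) -
      ω' * (ζ * P' + 2 * P ^ 2 - g₂ / 3))) * hs2
  · rw [← hL, PeriodPair.deformP_eq_of_periods x₁' x₂' hzL, PeriodPair.deformP_id hzL,
      hψ.deformP_eq hzL, rζ, rP, rP', rg₂]
    linear_combination (2 * c * (η * (z * P' + 2 * P) -
      ω * (ζ * P' + 2 * P ^ 2 - g₂ / 3))) * hs2
  · rw [← hL, PeriodPair.deformDerivP_eq_of_periods f₁' f₂' hzL, PeriodPair.deformDerivP_id hzL,
      hψ.deformDerivP_eq hzL, rζ, rP, rP', rg₂]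
    linear_combination (-2 * c * (η' * (z * (6 * P ^ 2 - g₂ / 2) + 3 * P') -
      ω' * (3 * P * P' + ζ * (6 * P ^ 2 - g₂ / 2)))) * hs2
  · rw [← hL, PeriodPair.deformDerivP_eq_of_periods x₁' x₂' hzL, PeriodPair.deformDerivP_id hzL,
      hψ.deformDerivP_eq hzL, rζ, rP, rP', rg₂]
    linear_combination (2 * c * (η * (z * (6 * P ^ 2 - g₂ / 2) + 3 * P') -
      ω * (3 * P * P' + ζ * (6 * P ^ 2 - g₂ / 2)))) * hs2
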